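/- **Setting.** Let $V$ be a finite set of nodes. Node $i$ carries a real process $x_i$ satisfying $$S_i x_i=\sum_{j\ne i} b_{ij}x_j+w_i ,$$ where $b_{ij}\in\mathbb R$, $S_i$ is convolution with an absolutely summable real impulse response whose frequency response $S_i(\omega)$ has no zero, and the $w_i$ are independent zero-mean wide-sense stationary (WSS) noises with positive power spectral densities $\Phi_{w_i}(\omega)$. All processes are jointly WSS with absolutely summable correlations; $\Phi_{XY}(\omega)=\sum_k \mathbb E[X[n+k]Y[n]]e^{-\mathrm i\omega k}$. Put $\mathcal G_{ij}=b_{ij}/S_i$ for $i\ne j$. The system is bidirected ($\mathcal G_{ij}\ne0\iff\mathcal G_{ji}\neq 0$), and its generative topology $G^T=(V,A)$, with $i-j\in A$ iff $\mathcal G_{ij}\ne0$, is a tree (the system is radial) in which every node has a node at distance $2$. A leaf is a node with exactly one neighbor. A set $Y_0\subseteq V$ of nodes is corrupt, and one measures $u$, where $u_i=x_i$ for $i\notin Y_0$ and, with $h_i=1,d_i=0$ for $i\notin Y_0$ and $h_i(\omega)\neq0$, $d_i(\omega)>0$ for $i\in Y_0$, for all $\omega$, $$\Phi_{u_ix_i}=h_i\Phi_{x_ix_i},\qquad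 \Phi_{u_iu_i}=h_i\overline{h_i}\,\Phi_{x_ix_i}+d_i,\qquad \Phi_{u_iu_j}=h_i\Phi_{x_ix_j}\overline{h_j}\quad(i\ne j).$$ Assume: (C1) corrupt nodes are at distance at least $3$ in $G^T$ from all leaves; (C2) distinct corrupt nodes are at distance at least $3$ in $G^T$ from each other. **Non-pathological parameters.** Let $\Phi_{oo}$ be the spectral matrix of $o=(u_i)_{i\notin Y_0}$. The parameters are called non-pathological if: (N1) for every edge $i-j$ of $G^T$, $\Phi_{xx}^{-1}(i,j)(\omega)$ is non-real for some $\omega\in(-\pi,\pi]$; (N2) for every corrupt $l$ and distinct neighbors $q,r$ of $l$ in $G^T$, $\Phi_{xx}^{-1}(q,l)(\omega)\,\Phi_{xx}^{-1}(l,r)(\omega)$ is non-real for some $\omega\in(-\pi,\pi]$; (N3) for every edge $i-j$ of $G^T$ between non-corrupt nodes, neither $\Phi_{uu}^{-1}(i,j)$ nor $\Phi_{oo}^{-1}(i,j)$ vanishes identically on $(-\pi,\pi]$. **Algorithm 1** (input: $u$). Let $G_Z$ be the graph on $V$ with an edge $i-j$ ($i\ne j$) whenever $\Phi_{uu}^{-1}(i,j)$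 is not identically zero on $(-\pi,\pi]$, and let $\mathcal N_u(i)$ be the set of neighbors of $i$ in $G_Z$. For each $i$ such that $\mathcal N_u(i)\cup\{i\}$ is a clique in $G_Z$, let $\epsilon_i$ be the set of edges $i-j$, $j\in\mathcal N_u(i)$, for which the phase $\angle\Phi_{uu}^{-1}(i,j)(\omega)$ is not constant on $(-\pi,\pi]$ (the phase being considered where the entry is nonzero). If $|\epsilon_i|\ge2$, put $i$ in $Y$; otherwise put $i$ in $L$ and the elements of $\epsilon_i$ in $\mathcal E_L$. Output $Y,L,\mathcal E_L$. **Algorithm 2, "hide and learn"** (input: $u,Y,L,\mathcal E_L$). Let $V_o=V\setminus Y$, and let $A_o$ be the set of edges $i-j$ ($i\ne j$ in $V_o$) for which the $(i,j)$ entry of the inverse spectral matrix of $(u_i)_{i\in V_o}$ is not identically zero on $(-\pi,\pi]$. Let $\mathcal E_T$ consist of $\mathcal E_L$ and all $p-q\in A_o$ with $p,q\in V\setminus(Y\cup L)$ for which there are nonempty $K,S\subseteq V_o\setminus\{p,q\}$ such that no path in $(V_o,A_o)$ avoiding $p$ and $q$ joins $K$ to $S$. Let $\Theta=(V_o,\mathcal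 E_T)$. Start with $A=\mathcal E_T$; for all edges $p-q$ and $r-s$ of $\Theta$ lying in different connected components of $\Theta$ and all $l\in Y$ such that $\{p,q,l,r,s\}$ is a clique in $G_Z$ and $\angle\Phi_{uu}^{-1}(p,s)$ is constant on $(-\pi,\pi]$, add $q-l$ and $l-r$ to $A$. Output $A$. (Each edge is considered in both orientations.) **Theorem.** 1. For every system as above with non-pathological parameters, Algorithm 1 returns $Y=Y_0$, $L=$ the set of leaves of $G^T$, and $\mathcal E_L=$ the set of edges of $G^T$ having a leaf as an endpoint; and Algorithm 2, run with these outputs, returns exactly the edge set of $G^T$. 2. Pathological parameters are negligible: fix a tree $T$ on $V$ in which every node has a node at distance $2$, a set $Y_0$ satisfying (C1) and (C2) in $T$, filters $S_i$ such that for every edge $i-j$ of $T$ the product $S_iS_j$ is non-real for some $\omega\in(-\pi,\pi]$, noise spectra $\Phi_{w_i}$, and functions $h_i,d_i$. Then for Lebesgue-almost every $\beta\in\mathbb R^{V\times V}$, every network (with corrupted measurements) as above having these data and couplings $b_{ij}=\beta_{ij}$ if $i-j\in T$, $b_{ij}=0$ otherwise, is bidirected, has generative topology $T$, and has non-pathological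 parameters. -/

import Mathlib

open MeasureTheory ProbabilityTheory

universe u v

noncomputable section

namespace HideLearn

/-! ## Second-order processes and their power spectra -/

section Spectra

variable {Ω : Type v} [MeasurableSpace Ω] {ι : Type u}

/-- Cross-correlation `R_{XY}(k) = E[X[n+k] Y[n]]`, evaluated at `n = 0`
(for jointly wide-sense stationary processes `n` is irrelevant). -/
def crossCorr (μ : Measure Ω) (X Y : ℤ → Ω → ℝ) (k : ℤ) : ℝ :=
  ∫ ω, X k ω * Y 0 ω ∂μ

/-- Discrete-time Fourier transform: the bilateral Z-transform at `z = exp (iθ)`. -/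
def dtft (r : ℤ → ℝ) (θ : ℝ) : ℂ :=
  ∑' k : ℤ, (r k : ℂ) * Complex.exp (-(Complex.I * (θ : ℂ) * (k : ℂ)))

/-- Cross-power spectral density `Φ_{XY}(θ)`. -/
def crossPSD (μ : Measure Ω) (X Y : ℤ → Ω → ℝ) (θ : ℝ) : ℂ :=
  dtft (crossCorr μ X Y) θ

/-- Power spectral density matrix of a vector process. -/
def psd (μ : Measure Ω) (X : ι → ℤ → Ω → ℝ) (θ : ℝ) : Matrix ι ι ℂ :=
  Matrix.of fun i j => crossPSD μ (X i) (X j) θ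

/-- Inverse power spectral density matrix of a vector process. -/
def invPSD [Fintype ι] [DecidableEq ι] (μ : Measure Ω) (X : ι → ℤ → Ω → ℝ) (θ : ℝ) :
    Matrix ι ι ℂ :=
  (psd μ X θ)⁻¹

/-- The real vector process `X` is (jointly) wide-sense stationary, with finite second moments
and absolutely summable correlations, so that its spectra exist at every frequency. -/
structure IsWSS (μ : Measure Ω) (X : ι → ℤ → Ω → ℝ) : Prop where
  memLp : ∀ i n, MemLp (X i n) 2 μ
  mean_const : ∀ i n, ∫ ω, X i n ω ∂μ = ∫ ω, X i 0 ω ∂μ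
  corr_shift : ∀ i j n k, ∫ ω, X i (n + k) ω * X j n ω ∂μ = crossCorr μ (X i) (X j) k
  summable_corr : ∀ i j, Summable fun k : ℤ => |crossCorr μ (X i) (X j) k|

end Spectra

/-! ## The generative model -/

section Model

variable {V : Type u} [DecidableEq V]

/-- Transfer functions `𝒢_{ij} = b_{ij} / S_i` (`i ≠ j`) of the system
`S_i x_i = ∑_{j ≠ i} b_{ij} x_j + w_i`, where `S_i` has impulse response `s i`. -/
def transfer (s : V → ℤ → ℝ) (b : V → V → ℝ) (i j : V) (θ : ℝ) : ℂ :=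
  if i = j then 0 else (b i j : ℂ) / dtft (s i) θ

/-- The directed link `i → j` of the generative graph: `𝒢_{ji} ≠ 0`. -/
def Link (s : V → ℤ → ℝ) (b : V → V → ℝ) (i j : V) : Prop :=
  ∃ θ : ℝ, transfer s b j i θ ≠ 0

/-- The generative graph is bidirected. -/
def IsBidirected (s : V → ℤ → ℝ) (b : V → V → ℝ) : Prop :=
  ∀ i j, Link s b i j → Link s b j i

/-- The generative topology: forget the directions in the generative graph. -/
def topology (s : V → ℤ → ℝ) (b : V → V → ℝ) : SimpleGraph V :=
  SimpleGraph.fromRel (Link s b)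

variable [Fintype V] {Ω : Type v} [MeasurableSpace Ω]

/-- `x` is generated by the linear time-invariant network with node filters `S_i` (impulse response
`s i`), couplings `b i j` and innate independent zero-mean noises `w i`. -/
structure IsGenerativeModel (μ : Measure Ω) (s : V → ℤ → ℝ) (b : V → V → ℝ)
    (w x : V → ℤ → Ω → ℝ) : Prop where
  filter_summable : ∀ i, Summable fun k : ℤ => |s i k|
  filter_ne_zero : ∀ i θ, dtft (s i) θ ≠ 0
  noise_wss : IsWSS μ w
  noise_mean : ∀ i n, ∫ ω, w i n ω ∂μ = 0
  noise_indep : iIndepFun (fun (i : V) (ω : Ω) (n : ℤ) => w i n ω) μ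
  noise_pos : ∀ i θ, 0 < (crossPSD μ (w i) (w i) θ).re
  state_wss : IsWSS μ x
  dynamics : ∀ i n, ∀ᵐ ω ∂μ,
    ∑' k : ℤ, s i k * x i (n - k) ω = ∑ j ∈ Finset.univ.erase i, b i j * x j n ω + w i n ω

/-- The measured process `u` is a corruption of `x` at exactly the nodes of `Y`: clean nodes are
measured perfectly, and the spectra are
`Φ_{u_i x_i} = h_i Φ_{x_i x_i}`, `Φ_{u_i u_i} = h_i h_i^* Φ_{x_i x_i} + d_i` and, the
corruptions at distinct nodes being independent, `Φ_{u_i u_j} = h_i Φ_{x_i x_j} h_j^*`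
(with `h_i = 1`, `d_i = 0` at clean nodes). -/
structure IsCorruption (μ : Measure Ω) (Y : Set V) (x y : V → ℤ → Ω → ℝ)
    (h : V → ℝ → ℂ) (d : V → ℝ → ℝ) : Prop where
  joint_wss : IsWSS μ (Sum.elim x y)
  clean : ∀ i, i ∉ Y → ∀ n, y i n =ᵐ[μ] x i n
  h_clean : ∀ i, i ∉ Y → ∀ θ, h i θ = 1
  d_clean : ∀ i, i ∉ Y → ∀ θ, d i θ = 0
  h_ne_zero : ∀ i, i ∈ Y → ∀ θ, h i θ ≠ 0
  d_pos : ∀ i, i ∈ Y → ∀ θ, 0 < d i θ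
  cross : ∀ i θ, crossPSD μ (y i) (x i) θ = h i θ * crossPSD μ (x i) (x i) θ
  auto : ∀ i θ, crossPSD μ (y i) (y i) θ =
    h i θ * star (h i θ) * crossPSD μ (x i) (x i) θ + (d i θ : ℂ)
  cross_distinct : ∀ i j, i ≠ j → ∀ θ, crossPSD μ (y i) (y j) θ =
    h i θ * crossPSD μ (x i) (x j) θ * star (h j θ)

end Model

/-! ## Location of the corrupt nodes -/

section Location

variable {V : Type u}

/-- A leaf: a node with exactly one neighbor. -/
def IsLeaf (T : SimpleGraph V) (i : V) : Prop :=
  (T.neighborSet i).ncard = 1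

/-- Corrupt nodes are at least 3 hops away from all leaves and from each other. -/
structure IsDeep (T : SimpleGraph V) (Y : Set V) : Prop where
  leaf : ∀ l ∈ Y, ∀ i, IsLeaf T i → 3 ≤ T.dist l i
  apart : ∀ l ∈ Y, ∀ m ∈ Y, l ≠ m → 3 ≤ T.dist l m

/-- Every node has a 2-hop neighbor. -/
def HasTwoHop (T : SimpleGraph V) : Prop :=
  ∀ i, ∃ j, T.dist i j = 2

end Location

/-! ## The algorithms -/

section Algorithms

/-- The undirected graph of the entries of `Θ` that do not vanish identically. -/
def supportGraph {ι : Type u} (Θ : ℝ → Matrix ι ι ℂ) : SimpleGraph ι :=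
  SimpleGraph.fromRel fun i j => ∃ θ ∈ Set.Ioc (-Real.pi) Real.pi, Θ θ i j ≠ 0

/-- The phase of `f` is constant on `(-π, π]` (the phase of `0` being undefined). -/
def HasConstantPhase (f : ℝ → ℂ) : Prop :=
  ∃ c : ℝ, ∀ θ ∈ Set.Ioc (-Real.pi) Real.pi, f θ ≠ 0 → (f θ).arg = c

/-- The node and its neighborhood form a clique. -/
def IsCandidate {V : Type u} (G : SimpleGraph V) (i : V) : Prop :=
  G.IsClique (insert i (G.neighborSet i))

/-- The edges `i - j` of the support graph at `i` whose entry has non-constant phase. -/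
def phaseEdges {V : Type u} (Θ : ℝ → Matrix V V ℂ) (i : V) : Set (Sym2 V) :=
  {e | ∃ j, (supportGraph Θ).Adj i j ∧ ¬ HasConstantPhase (fun θ => Θ θ i j) ∧ e = s(i, j)}

/-- Output of the detection algorithm. -/
structure Detection (V : Type u) where
  corrupt : Set V
  leaves : Set V
  leafEdges : Set (Sym2 V)

variable {Ω : Type v} [MeasurableSpace Ω] {V : Type u} [Fintype V] [DecidableEq V]

/-- Detection of corrupt nodes, leaves and leaf edges from the measured time series. -/
def detect (μ : Measure Ω) (y : V → ℤ → Ω → ℝ) : Detection V where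
  corrupt := {i | IsCandidate (supportGraph (invPSD μ y)) i ∧ 2 ≤ (phaseEdges (invPSD μ y) i).ncard}
  leaves := {i | IsCandidate (supportGraph (invPSD μ y)) i ∧
    ¬ 2 ≤ (phaseEdges (invPSD μ y) i).ncard}
  leafEdges := {e | ∃ i, IsCandidate (supportGraph (invPSD μ y)) i ∧
    ¬ 2 ≤ (phaseEdges (invPSD μ y) i).ncard ∧ e ∈ phaseEdges (invPSD μ y) i}

open Classical in
/-- Inverse power spectral density of the measurements at the nodes outside `C`. -/
def hiddenInvPSD (μ : Measure Ω) (y : V → ℤ → Ω → ℝ) (C : Set V) (θ : ℝ) :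
    Matrix {i : V // i ∉ C} {i : V // i ∉ C} ℂ :=
  invPSD μ (fun i : {i : V // i ∉ C} => y i.1) θ

/-- `sep(K, S | Z)`: after removing `Z`, no path joins a node of `K` to a node of `S`. -/
def Separates {ι : Type u} (G : SimpleGraph ι) (K S Z : Set ι) : Prop :=
  Disjoint K Z ∧ Disjoint S Z ∧
    ∀ k ∈ K, ∀ t ∈ S, ∀ p : G.Walk k t, ∃ z ∈ Z, z ∈ p.support

/-- First half of "hide and learn": the graph `Θ` on the observed nodes whose edges are the given
leaf edges together with the edges `p - q` of the graph inferred with the corrupt nodes hidden,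
`p`, `q` not leaves, for which `{p, q}` separates two nonempty sets of observed nodes. -/
def observedGraph (μ : Measure Ω) (y : V → ℤ → Ω → ℝ) (D : Detection V) :
    SimpleGraph {i : V // i ∉ D.corrupt} :=
  SimpleGraph.fromRel fun p q =>
    s(p.1, q.1) ∈ D.leafEdges ∨
    (p.1 ∉ D.leaves ∧ q.1 ∉ D.leaves ∧
      (supportGraph (hiddenInvPSD μ y D.corrupt)).Adj p q ∧
      ∃ K S : Set {i : V // i ∉ D.corrupt}, K.Nonempty ∧ S.Nonempty ∧
        Separates (supportGraph (hiddenInvPSD μ y D.corrupt)) K S {p, q})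

/-- Second half of "hide and learn": `l` is placed between `q` and `r`, nodes of distinct
components of `Θ` with `Θ`-neighbors `p` and `t` respectively, when `{p, q, l, r, t}` is a clique in
the graph inferred from all measurements and the `(p, t)` entry has constant phase. -/
def Placed (μ : Measure Ω) (y : V → ℤ → Ω → ℝ) (D : Detection V) (q l r : V) : Prop :=
  ∃ p' q' r' t' : {i : V // i ∉ D.corrupt},
    q'.1 = q ∧ r'.1 = r ∧ l ∈ D.corrupt ∧
    (observedGraph μ y D).connectedComponentMk q' ≠ (observedGraph μ y D).connectedComponentMk r' ∧
    (observedGraph μ y D).Adj p' q' ∧ (observedGraph μ y D).Adj t' r' ∧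
    (supportGraph (invPSD μ y)).IsClique {p'.1, q, l, r, t'.1} ∧
    HasConstantPhase (fun θ => invPSD μ y θ p'.1 t'.1)

/-- The edge set returned by "hide and learn". -/
def hideAndLearn (μ : Measure Ω) (y : V → ℤ → Ω → ℝ) (D : Detection V) : Set (Sym2 V) :=
  {e | ∃ p q : {i : V // i ∉ D.corrupt}, (observedGraph μ y D).Adj p q ∧ e = s(p.1, q.1)} ∪
  {e | ∃ q l r : V, Placed μ y D q l r ∧ (e = s(q, l) ∨ e = s(l, r))}

end Algorithms

/-! ## Exclusion of pathological parameters -/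

section Generic

variable {V : Type u}

/-- The coupling matrix supported on the edges of `T` with coefficients `β`. -/
def couplingOn (T : SimpleGraph V) (β : V → V → ℝ) (i j : V) : ℝ :=
  open Classical in if T.Adj i j then β i j else 0

variable [Fintype V] [DecidableEq V] {Ω : Type v} [MeasurableSpace Ω]

/-- No accidental coincidence of the system parameters. The first two conditions concern the
uncorrupted system only: the entries of `Φ_xx⁻¹` on edges are not real-valued, nor are the
products of the two entries joining a corrupt node to two of its neighbors. The last two say that
an edge between clean nodes is not exactly cancelled, at all frequencies, in the inverse spectra of
the measurements and of the clean measurements. -/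
structure IsNondegenerate (μ : Measure Ω) (T : SimpleGraph V) (Y : Set V)
    (x y : V → ℤ → Ω → ℝ) : Prop where
  edge : ∀ i j, T.Adj i j →
    ∃ θ ∈ Set.Ioc (-Real.pi) Real.pi, (invPSD μ x θ i j).im ≠ 0
  corner : ∀ l ∈ Y, ∀ q r, T.Adj q l → T.Adj l r → q ≠ r →
    ∃ θ ∈ Set.Ioc (-Real.pi) Real.pi, (invPSD μ x θ q l * invPSD μ x θ l r).im ≠ 0
  measured : ∀ i j, i ∉ Y → j ∉ Y → T.Adj i j →
    ∃ θ ∈ Set.Ioc (-Real.pi) Real.pi, invPSD μ y θ i j ≠ 0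
  hidden : ∀ i j : {i : V // i ∉ Y}, T.Adj i.1 j.1 →
    ∃ θ ∈ Set.Ioc (-Real.pi) Real.pi, hiddenInvPSD μ y Y θ i j ≠ 0

end Generic

end HideLearn

end

/-!
At each frequency the dynamics read `(S - B) x = w`, so `Φ_ww = (S - B) Φ_xx (S - B)^*`
(`IsGenerativeModel.psd_noise`), where `Φ_ww` is diagonal and positive by independence of the
noises. Hence `P = Φ_xx⁻¹ = (S - B)^* Φ_ww⁻¹ (S - B)` (`precision`). On a tree, `P` vanishes beyond
distance two, its entry at two nodes with a common neighbor `m` is the real number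
`b_mi b_mj / φ_m` (`precision_two_hop`), and its entries along edges are not real.

Corrupt nodes are at distance at least three from each other, so the block of `P` at the corrupt
nodes is diagonal, and both the inverse spectrum of the measurements (up to the factors `h`) and
that of the measurements with the corrupt nodes hidden have the form `P - P diag(γ) P` with weights
`0 < γ_l ≤ 1 / P_ll` on the corrupt nodes (`IsCorruption.invPSD_measured`,
`IsCorruption.hiddenInvPSD_measured`). For nodes at distance at least two at most one corrupt node
contributes (`IsTree.near_near`), which gives both the support of these matrices (pairs within two
hops of each other or of a common corrupt node, `TreeNetwork.corrected_ne_zero_iff`) and the phases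
the algorithms inspect. Since the processes are real, the entries are conjugate symmetric in the
frequency, and constant phase means real (`HasConstantPhase.im_eq_zero`).

The rest is combinatorics of trees, based on the fact that vertices on two sides of an edge are
joined through it (`IsTree.dist_across`). The nodes with a clique for neighborhood are the leaves
and the corrupt nodes (`RevealsTree.isCandidate_iff`), told apart by the number of edges of
nonconstant phase. With the corrupt nodes hidden, two clean nonleaves separate other nodes exactly
if they are adjacent in the tree (`exists_separated`, `adj_of_separates`): otherwise geodesics can
bypass them. Finally the phase test leaves only the true position of a corrupt node
(`placed_imp`, `exists_placed`).

For the second half, each nondegeneracy condition says that a real-analytic function of the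
couplings does not vanish; such a function, if nonzero somewhere, vanishes on a null set only
(`AnalyticZerosNull.pi`, by Fubini), and couplings supported on one or two directed edges are
witnesses (`ae_edge`, `ae_corner`, `ae_corrected_ne_zero`).
-/

noncomputable section

namespace HideLearn

/-! ### Zero sets of real-analytic functions -/

/-- Nonzero real-analytic functions on `E` vanish only on a null set. -/
def AnalyticZerosNull (E : Type*) [NormedAddCommGroup E] [NormedSpace ℝ E] [MeasureSpace E] :
    Prop :=
  ∀ f : E → ℂ, AnalyticOnNhd ℝ f Set.univ → (∃ x, f x ≠ 0) → ∀ᵐ x : E, f x ≠ 0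

theorem analyticZerosNull_real : AnalyticZerosNull ℝ := by
  rintro f hf ⟨x, hx⟩
  have h := hf.preimage_zero_mem_codiscrete hx
  have h2 := ae_restrict_le_codiscreteWithin (μ := (volume : Measure ℝ)) MeasurableSet.univ h
  rw [Measure.restrict_univ] at h2
  filter_upwards [h2] with y hy using hy

theorem AnalyticZerosNull.prod {E F : Type*} [NormedAddCommGroup E] [NormedSpace ℝ E]
    [MeasureSpace E] [NormedAddCommGroup F] [NormedSpace ℝ F] [MeasureSpace F]
    [OpensMeasurableSpace E] [OpensMeasurableSpace F] [SecondCountableTopology E]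
    [SFinite (volume : Measure F)]
    (hE : AnalyticZerosNull E) (hF : AnalyticZerosNull F) : AnalyticZerosNull (E × F) := by
  rintro f hf ⟨⟨x₀, y₀⟩, h₀⟩
  have hm : MeasurableSet {p : E × F | f p ≠ 0} :=
    (isOpen_ne.preimage (continuousOn_univ.1 hf.continuousOn)).measurableSet
  refine (Measure.ae_prod_mem_iff_ae_ae_mem (μ := (volume : Measure E))
    (ν := (volume : Measure F)) hm).2 ?_
  have h1 : AnalyticOnNhd ℝ (fun x => f (x, y₀)) Set.univ := fun x _ =>
    (hf (x, y₀) trivial).comp (f := fun x : E => (x, y₀)) (analyticAt_id.prod analyticAt_const)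
  filter_upwards [hE _ h1 ⟨x₀, h₀⟩] with x hx
  exact hF (fun y => f (x, y)) (fun y _ =>
    (hf (x, y) trivial).comp (f := fun y : F => (x, y))
      (analyticAt_const.prod analyticAt_id)) ⟨y₀, hx⟩

/-- Transfer along a measure-preserving map `e` with a linear left inverse. -/
theorem AnalyticZerosNull.of_equiv {E F : Type*} [NormedAddCommGroup E] [NormedSpace ℝ E]
    [MeasureSpace E] [NormedAddCommGroup F] [NormedSpace ℝ F] [MeasureSpace F]
    (hE : AnalyticZerosNull E) (e : F → E) (he : MeasurePreserving e volume volume)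
    (e' : E →L[ℝ] F) (hl : ∀ y, e' (e y) = y) : AnalyticZerosNull F := by
  rintro f hf ⟨y, hy⟩
  have h := hE (fun x => f (e' x)) (fun x _ => (hf _ trivial).comp (e'.analyticAt x))
    ⟨e y, by rwa [hl]⟩
  filter_upwards [he.quasiMeasurePreserving.ae h] with z hz
  rwa [hl] at hz

theorem AnalyticZerosNull.fin_pi {E : Type*} [NormedAddCommGroup E] [NormedSpace ℝ E]
    [MeasureSpace E] [OpensMeasurableSpace E] [SecondCountableTopology E]
    [SigmaFinite (volume : Measure E)]
    (hE : AnalyticZerosNull E) : ∀ n : ℕ, AnalyticZerosNull (Fin n → E)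
  | 0 => by
    rintro f - ⟨x, hx⟩
    exact Filter.Eventually.of_forall fun y => by rwa [Subsingleton.elim y x]
  | n + 1 => by
    refine (hE.prod (hE.fin_pi n)).of_equiv _
      (volume_preserving_piFinSuccAbove (fun _ => E) 0)
      (Fin.consEquivL ℝ (fun _ : Fin (n + 1) => E) : E × (Fin n → E) →L[ℝ] (Fin (n + 1) → E)) ?_
    intro y
    exact Fin.cons_self_tail y

/-- A power of a space on which analytic functions have null zero sets has the same property. -/
theorem AnalyticZerosNull.pi {E ι : Type*} [NormedAddCommGroup E] [NormedSpace ℝ E]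
    [MeasureSpace E] [OpensMeasurableSpace E] [SecondCountableTopology E]
    [SigmaFinite (volume : Measure E)] [Fintype ι]
    (hE : AnalyticZerosNull E) : AnalyticZerosNull (ι → E) := by
  let e := Fintype.equivFin ι
  refine (hE.fin_pi (Fintype.card ι)).of_equiv _
    (volume_measurePreserving_piCongrLeft (fun _ : Fin (Fintype.card ι) => E) e)
    (ContinuousLinearMap.pi fun i => ContinuousLinearMap.proj (e i)) ?_
  intro y
  ext i
  change MeasurableEquiv.piCongrLeft (fun _ : Fin (Fintype.card ι) => E) e y (e i) = y i
  exact Equiv.piCongrLeft_apply_apply (fun _ => E) e y i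

theorem analyticZerosNull_couplings (V : Type*) [Fintype V] : AnalyticZerosNull (V → V → ℝ) :=
  analyticZerosNull_real.pi.pi

/-! ### Transforms of summable sequences -/

theorem norm_dtft_term (r : ℤ → ℝ) (θ : ℝ) (k : ℤ) :
    ‖(r k : ℂ) * Complex.exp (-(Complex.I * (θ : ℂ) * (k : ℂ)))‖ = |r k| := by
  rw [norm_mul, Complex.norm_real, Real.norm_eq_abs, Complex.norm_exp]
  simp

theorem summable_dtft {r : ℤ → ℝ} (hr : Summable fun k => |r k|) (θ : ℝ) :
    Summable fun k : ℤ => (r k : ℂ) * Complex.exp (-(Complex.I * (θ : ℂ) * (k : ℂ))) :=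
  Summable.of_norm (by simpa only [norm_dtft_term] using hr)

theorem dtft_neg (r : ℤ → ℝ) (θ : ℝ) : dtft r (-θ) = star (dtft r θ) := by
  simp only [dtft, Complex.star_def, Complex.conj_tsum]
  refine tsum_congr fun k => ?_
  simp [← Complex.exp_conj]

theorem dtft_neg_pi (r : ℤ → ℝ) : dtft r (-Real.pi) = dtft r Real.pi := by
  refine tsum_congr fun k => ?_
  congr 1
  rw [Complex.exp_eq_exp_iff_exists_int]
  exact ⟨k, by push_cast; ring⟩

theorem dtft_add {f g : ℤ → ℝ} (hf : Summable fun k => |f k|) (hg : Summable fun k => |g k|)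
    (θ : ℝ) : dtft (fun k => f k + g k) θ = dtft f θ + dtft g θ := by
  simp only [dtft, Complex.ofReal_add, add_mul]
  exact (summable_dtft hf θ).tsum_add (summable_dtft hg θ)

theorem dtft_const_mul (c : ℝ) (f : ℤ → ℝ) (θ : ℝ) :
    dtft (fun k => c * f k) θ = c * dtft f θ := by
  simp only [dtft, Complex.ofReal_mul, mul_assoc]
  exact tsum_mul_left

theorem dtft_sum {ι : Type*} (t : Finset ι) {f : ι → ℤ → ℝ}
    (hf : ∀ i ∈ t, Summable fun k => |f i k|) (θ : ℝ) :
    dtft (fun k => ∑ i ∈ t, f i k) θ = ∑ i ∈ t, dtft (f i) θ := by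
  simp only [dtft, Complex.ofReal_sum, Finset.sum_mul]
  exact Summable.tsum_finsetSum fun i hi => summable_dtft (hf i hi) θ

/-- The shear `(l, m) ↦ (l, l + m)`. -/
def shear : ℤ × ℤ ≃ ℤ × ℤ where
  toFun p := (p.1, p.1 + p.2)
  invFun p := (p.1, p.2 - p.1)
  left_inv p := by simp
  right_inv p := by simp

theorem summable_conv_prod {f r : ℤ → ℝ} (hf : Summable fun k => |f k|)
    (hr : Summable fun k => |r k|) :
    Summable fun p : ℤ × ℤ => |f p.1 * r (p.2 - p.1)| := by
  rw [← shear.summable_iff]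
  have h := (Summable.mul_of_nonneg hf hr (fun _ => abs_nonneg _) (fun _ => abs_nonneg _))
  refine h.congr fun p => ?_
  simp [shear, abs_mul]

theorem summable_conv {f r : ℤ → ℝ} (hf : Summable fun k => |f k|)
    (hr : Summable fun k => |r k|) :
    Summable fun k : ℤ => |∑' l : ℤ, f l * r (k - l)| := by
  have h := ((Equiv.prodComm ℤ ℤ).summable_iff.2 (summable_conv_prod hf hr))
  refine Summable.of_nonneg_of_le (fun _ => abs_nonneg _) (fun k => ?_) h.prod
  have h2 := h.prod_factor k
  simpa [Real.norm_eq_abs] using norm_tsum_le_tsum_norm (f := fun l => f l * r (k - l))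
    (by simpa [Real.norm_eq_abs] using h2)

theorem dtft_conv {f r : ℤ → ℝ} (hf : Summable fun k => |f k|)
    (hr : Summable fun k => |r k|) (θ : ℝ) :
    dtft (fun k => ∑' l : ℤ, f l * r (k - l)) θ = dtft f θ * dtft r θ := by
  have hsum : Summable fun p : ℤ × ℤ => ((f p.1 * r (p.2 - p.1) : ℝ) : ℂ) *
      Complex.exp (-(Complex.I * (θ : ℂ) * (p.2 : ℂ))) := by
    refine Summable.of_norm ?_
    refine (summable_conv_prod hf hr).congr fun p => ?_
    rw [norm_mul, Complex.norm_real, Real.norm_eq_abs, Complex.norm_exp]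
    simp
  have hprod := tsum_mul_tsum_of_summable_norm (summable_dtft hf θ).norm (summable_dtft hr θ).norm
  unfold dtft
  rw [hprod, ← shear.symm.tsum_eq]
  have hs2 := (Equiv.prodComm ℤ ℤ).summable_iff.2 hsum
  calc _ = ∑' k : ℤ, ∑' l : ℤ, ((f l * r (k - l) : ℝ) : ℂ) *
        Complex.exp (-(Complex.I * (θ : ℂ) * (k : ℂ))) := by
        refine tsum_congr fun k => ?_
        rw [Complex.ofReal_tsum, tsum_mul_right]
    _ = ∑' p : ℤ × ℤ, ((f p.2 * r (p.1 - p.2) : ℝ) : ℂ) *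
        Complex.exp (-(Complex.I * (θ : ℂ) * (p.1 : ℂ))) := (hs2.tsum_prod).symm
    _ = ∑' p : ℤ × ℤ, ((f p.1 * r (p.2 - p.1) : ℝ) : ℂ) *
        Complex.exp (-(Complex.I * (θ : ℂ) * (p.2 : ℂ))) :=
        (Equiv.prodComm ℤ ℤ).tsum_eq (fun p : ℤ × ℤ => ((f p.1 * r (p.2 - p.1) : ℝ) : ℂ) *
        Complex.exp (-(Complex.I * (θ : ℂ) * (p.2 : ℂ))))
    _ = _ := by
        refine tsum_congr fun p => ?_
        simp only [shear, Equiv.coe_fn_symm_mk, Complex.ofReal_mul]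
        rw [mul_mul_mul_comm, ← Complex.exp_add]
        congr 2
        push_cast
        ring

theorem dtft_reflect (f : ℤ → ℝ) (θ : ℝ) : dtft (fun k => f (-k)) θ = star (dtft f θ) := by
  rw [← dtft_neg]
  unfold dtft
  rw [← (Equiv.neg ℤ).tsum_eq]
  refine tsum_congr fun k => ?_
  simp

/-- Filtering the second argument of a correlation multiplies its transform by the conjugate
frequency response. -/
theorem dtft_corr {f r : ℤ → ℝ} (hf : Summable fun k => |f k|)
    (hr : Summable fun k => |r k|) (θ : ℝ) :
    dtft (fun k => ∑' l : ℤ, f l * r (k + l)) θ = star (dtft f θ) * dtft r θ := by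
  have hf' : Summable fun k => |f (-k)| := (Equiv.neg ℤ).summable_iff.2 hf
  rw [← dtft_reflect, ← dtft_conv hf' hr]
  congr 1
  ext k
  rw [← (Equiv.neg ℤ).tsum_eq]
  simp [sub_eq_add_neg]

theorem summable_corr_filter {f r : ℤ → ℝ} (hf : Summable fun k => |f k|)
    (hr : Summable fun k => |r k|) :
    Summable fun k : ℤ => |∑' l : ℤ, f l * r (k + l)| := by
  have hf' : Summable fun k => |f (-k)| := (Equiv.neg ℤ).summable_iff.2 hf
  refine (summable_conv hf' hr).congr fun k => ?_
  congr 1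
  rw [← (Equiv.neg ℤ).tsum_eq]
  simp

/-! ### Spectra of the generated process -/

section Spectral

variable {Ω : Type v} [MeasurableSpace Ω] {μ : Measure Ω}

theorem IsWSS.integral_mul {ι : Type*} {X : ι → ℤ → Ω → ℝ} (hX : IsWSS μ X) (i j : ι) (m n : ℤ) :
    ∫ ω, X i m ω * X j n ω ∂μ = crossCorr μ (X i) (X j) (m - n) := by
  rw [← hX.corr_shift i j n (m - n)]
  simp

theorem integral_abs_mul_le {f g : Ω → ℝ} (hf : MemLp f 2 μ) (hg : MemLp g 2 μ) :
    ∫ ω, |f ω * g ω| ∂μ ≤ (∫ ω, f ω * f ω ∂μ) + ∫ ω, g ω * g ω ∂μ := by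
  have hadd := integral_add (hf.integrable_mul hf) (hg.integrable_mul hg)
  simp only [Pi.mul_apply] at hadd
  rw [← hadd]
  refine integral_mono (hf.integrable_mul hg).abs
    ((hf.integrable_mul hf).add (hg.integrable_mul hg)) fun ω => ?_
  change |f ω * g ω| ≤ f ω * f ω + g ω * g ω
  rw [abs_le]
  constructor <;> nlinarith [sq_nonneg (f ω + g ω), sq_nonneg (f ω - g ω)]

variable {V : Type u} [DecidableEq V]

/-- The matrix `S - B` at a frequency where the filters have frequency responses `S`. -/
def netMatrix (S : V → ℂ) (b : V → V → ℝ) : Matrix V V ℂ :=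
  Matrix.of fun i j => if i = j then S i else -(b i j : ℂ)

@[simp] theorem netMatrix_diag (S : V → ℂ) (b : V → V → ℝ) (i : V) : netMatrix S b i i = S i := by
  simp [netMatrix]

theorem netMatrix_offdiag (S : V → ℂ) (b : V → V → ℝ) {i j : V} (h : i ≠ j) :
    netMatrix S b i j = -(b i j : ℂ) := by
  simp [netMatrix, h]

variable [Fintype V] {s : V → ℤ → ℝ} {b : V → V → ℝ}
  {w x : V → ℤ → Ω → ℝ}

/-- Correlation of the noise with an arbitrary square-integrable variable, read off from the
dynamics by exchanging the filter with the expectation. -/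
theorem IsGenerativeModel.integral_noise_mul (hm : IsGenerativeModel μ s b w x) (i : V) (n : ℤ)
    {Z : Ω → ℝ} (hZ : MemLp Z 2 μ) :
    ∫ ω, w i n ω * Z ω ∂μ = (∑' l : ℤ, s i l * ∫ ω, x i (n - l) ω * Z ω ∂μ) -
      ∑ j ∈ Finset.univ.erase i, b i j * ∫ ω, x j n ω * Z ω ∂μ := by
  have hx := hm.state_wss.memLp
  have hint : ∀ j m, Integrable (fun ω => x j m ω * Z ω) μ := fun j m =>
    (hx j m).integrable_mul hZ
  have hkey : ∫ ω, (∑' l : ℤ, s i l * (x i (n - l) ω * Z ω)) ∂μ =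
      ∑' l : ℤ, s i l * ∫ ω, x i (n - l) ω * Z ω ∂μ := by
    rw [← integral_tsum_of_summable_integral_norm]
    · exact tsum_congr fun l => integral_const_mul _ _
    · exact fun l => (hint i (n - l)).const_mul _
    · set C := crossCorr μ (x i) (x i) 0 + ∫ ω, Z ω * Z ω ∂μ
      refine Summable.of_nonneg_of_le (fun l => integral_nonneg fun ω => norm_nonneg _)
        (fun l => ?_) ((hm.filter_summable i).mul_right C)
      simp only [norm_mul (s i l), Real.norm_eq_abs]
      rw [integral_const_mul]
      refine mul_le_mul_of_nonneg_left ?_ (abs_nonneg _)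
      have h := integral_abs_mul_le (hx i (n - l)) hZ
      rwa [hm.state_wss.integral_mul, sub_self] at h
  have hdyn : (fun ω => w i n ω * Z ω) =ᵐ[μ] fun ω =>
      (∑' l : ℤ, s i l * (x i (n - l) ω * Z ω)) -
        ∑ j ∈ Finset.univ.erase i, b i j * (x j n ω * Z ω) := by
    filter_upwards [hm.dynamics i n] with ω hω
    have : w i n ω = (∑' k : ℤ, s i k * x i (n - k) ω) -
        ∑ j ∈ Finset.univ.erase i, b i j * x j n ω := by rw [hω]; ring
    rw [this, sub_mul, ← tsum_mul_right, Finset.sum_mul]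
    simp only [mul_assoc]
  have hsum : Integrable (fun ω => ∑ j ∈ Finset.univ.erase i, b i j * (x j n ω * Z ω)) μ :=
    integrable_finsetSum _ fun j _ => (hint j n).const_mul _
  have hts : Integrable (fun ω => ∑' l : ℤ, s i l * (x i (n - l) ω * Z ω)) μ := by
    -- the filtered process inherits integrability from the noise through the dynamics
    refine (((hm.noise_wss.memLp i n).integrable_mul hZ).add hsum).congr ?_
    filter_upwards [hdyn] with ω hω
    change w i n ω * Z ω + _ = _
    rw [hω]; ring
  rw [integral_congr_ae hdyn, integral_sub hts hsum, hkey,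
    integral_finsetSum _ fun j _ => (hint j n).const_mul _]
  simp only [integral_const_mul]

theorem netMatrix_sum (S : V → ℂ) (b : V → V → ℝ) (i : V) (f : V → ℂ) :
    ∑ j, netMatrix S b i j * f j = S i * f i - ∑ j ∈ Finset.univ.erase i, (b i j : ℂ) * f j := by
  rw [← Finset.add_sum_erase _ _ (Finset.mem_univ i), netMatrix_diag, sub_eq_add_neg,
    ← Finset.sum_neg_distrib]
  congr 1
  refine Finset.sum_congr rfl fun j hj => ?_
  rw [netMatrix_offdiag S b (Finset.ne_of_mem_erase hj).symm, neg_mul]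

/-- Correlation between noise and state, as a filtered state correlation. -/
def noiseStateCorr (μ : Measure Ω) (s : V → ℤ → ℝ) (b : V → V → ℝ) (x : V → ℤ → Ω → ℝ)
    (i j : V) (k : ℤ) : ℝ :=
  (∑' l : ℤ, s i l * crossCorr μ (x i) (x j) (k - l)) +
    ∑ p ∈ Finset.univ.erase i, -b i p * crossCorr μ (x p) (x j) k

theorem IsGenerativeModel.integral_noise_state (hm : IsGenerativeModel μ s b w x) (i j : V)
    (m n : ℤ) : ∫ ω, w i m ω * x j n ω ∂μ = noiseStateCorr μ s b x i j (m - n) := by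
  rw [hm.integral_noise_mul i m (hm.state_wss.memLp j n), noiseStateCorr]
  simp only [hm.state_wss.integral_mul, neg_mul, Finset.sum_neg_distrib, ← sub_eq_add_neg]
  congr 1
  refine tsum_congr fun l => ?_
  congr 2
  ring

theorem summable_abs_finset_sum {ι : Type*} (t : Finset ι) {f : ι → ℤ → ℝ}
    (hf : ∀ i ∈ t, Summable fun k => |f i k|) : Summable fun k => |∑ i ∈ t, f i k| :=
  Summable.of_nonneg_of_le (fun _ => abs_nonneg _) (fun _ => Finset.abs_sum_le_sum_abs _ _)
    (summable_sum hf)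

theorem summable_abs_add {f g : ℤ → ℝ} (hf : Summable fun k => |f k|)
    (hg : Summable fun k => |g k|) : Summable fun k => |f k + g k| :=
  Summable.of_nonneg_of_le (fun _ => abs_nonneg _) (fun _ => abs_add_le _ _) (hf.add hg)

theorem summable_abs_const_mul (c : ℝ) {f : ℤ → ℝ} (hf : Summable fun k => |f k|) :
    Summable fun k => |c * f k| := by
  simpa only [abs_mul] using hf.mul_left |c|

theorem IsGenerativeModel.summable_noiseStateCorr (hm : IsGenerativeModel μ s b w x) (i j : V) :
    Summable fun k => |noiseStateCorr μ s b x i j k| :=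
  summable_abs_add (summable_conv (hm.filter_summable i) (hm.state_wss.summable_corr i j))
    (summable_abs_finset_sum _ fun p _ =>
      summable_abs_const_mul _ (hm.state_wss.summable_corr p j))

theorem IsGenerativeModel.dtft_noiseStateCorr (hm : IsGenerativeModel μ s b w x) (i j : V)
    (θ : ℝ) : dtft (noiseStateCorr μ s b x i j) θ =
      (netMatrix (fun i => dtft (s i) θ) b * psd μ x θ) i j := by
  have hc := hm.state_wss.summable_corr
  unfold noiseStateCorr
  rw [dtft_add (summable_conv (hm.filter_summable i) (hc i j)) (summable_abs_finset_sum _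
    fun p _ => summable_abs_const_mul _ (hc p j)), dtft_conv (hm.filter_summable i) (hc i j),
    dtft_sum _ fun p _ => summable_abs_const_mul _ (hc p j), Matrix.mul_apply, netMatrix_sum,
    sub_eq_add_neg, ← Finset.sum_neg_distrib]
  simp only [dtft_const_mul]
  simp [psd, crossPSD]

theorem IsGenerativeModel.crossCorr_noise (hm : IsGenerativeModel μ s b w x) (i j : V) (k : ℤ) :
    crossCorr μ (w i) (w j) k = (∑' l : ℤ, s j l * noiseStateCorr μ s b x i j (k + l)) +
      ∑ p ∈ Finset.univ.erase j, -b j p * noiseStateCorr μ s b x i p k := by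
  have h := hm.integral_noise_mul j 0 (hm.noise_wss.memLp i k)
  simp only [mul_comm (x _ _ _) _, hm.integral_noise_state] at h
  rw [crossCorr]
  simp only [mul_comm (w i _ _) _, h, neg_mul, Finset.sum_neg_distrib, ← sub_eq_add_neg]
  simp

/-- The spectral identity `Φ_ww = (S - B) Φ_xx (S - B)^*`. -/
theorem IsGenerativeModel.psd_noise (hm : IsGenerativeModel μ s b w x) (θ : ℝ) :
    psd μ w θ = netMatrix (fun i => dtft (s i) θ) b * psd μ x θ *
      (netMatrix (fun i => dtft (s i) θ) b).conjTranspose := by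
  ext i j
  have hc := hm.summable_noiseStateCorr
  have h1 : psd μ w θ i j = dtft (crossCorr μ (w i) (w j)) θ := rfl
  rw [h1, funext (hm.crossCorr_noise i j),
    dtft_add (summable_corr_filter (hm.filter_summable j) (hc i j)) (summable_abs_finset_sum _
    fun p _ => summable_abs_const_mul _ (hc i p)), dtft_corr (hm.filter_summable j) (hc i j),
    dtft_sum _ fun p _ => summable_abs_const_mul _ (hc i p)]
  simp only [dtft_const_mul, hm.dtft_noiseStateCorr]
  generalize netMatrix (fun i => dtft (s i) θ) b * psd μ x θ = N
  rw [Matrix.mul_apply]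
  have h2 := congrArg star (netMatrix_sum (fun i => dtft (s i) θ) b j fun p => star (N i p))
  simp only [star_sum, star_mul', star_star, star_sub] at h2
  simp only [Matrix.conjTranspose_apply]
  rw [Finset.sum_congr rfl fun p _ => mul_comm (N i p) _, h2, sub_eq_add_neg,
    ← Finset.sum_neg_distrib]
  simp

theorem IsGenerativeModel.psd_noise_eq_diagonal [IsProbabilityMeasure μ]
    (hm : IsGenerativeModel μ s b w x) (θ : ℝ) :
    psd μ w θ = Matrix.diagonal fun i => ((crossPSD μ (w i) (w i) θ).re : ℂ) := by
  ext i j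
  by_cases hij : i = j
  · subst hij
    rw [Matrix.diagonal_apply_eq]
    -- the spectrum is real because the autocorrelation is even
    have hreal : star (crossPSD μ (w i) (w i) θ) = crossPSD μ (w i) (w i) θ := by
      change star (dtft _ θ) = dtft _ θ
      rw [← dtft_reflect]
      congr 1
      ext k
      have h := hm.noise_wss.integral_mul i i 0 k
      rw [zero_sub] at h
      rw [← h, crossCorr]
      simp only [mul_comm]
    exact (Complex.conj_eq_iff_re.1 hreal).symm
  · rw [Matrix.diagonal_apply_ne _ hij]
    have h0 : crossCorr μ (w i) (w j) = fun _ => 0 := by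
      ext k
      have hind : IndepFun (w i k) (w j 0) μ :=
        (hm.noise_indep.indepFun hij).comp (measurable_pi_apply k) (measurable_pi_apply (0 : ℤ))
      have h := hind.integral_fun_mul_eq_mul_integral
        (hm.noise_wss.memLp i k).aestronglyMeasurable (hm.noise_wss.memLp j 0).aestronglyMeasurable
      rw [crossCorr, h, hm.noise_mean, zero_mul]
    change dtft (crossCorr μ (w i) (w j)) θ = 0
    simp [h0, dtft]

end Spectral

/-! ### Distances in trees -/

section Tree

variable {V : Type u} {T : SimpleGraph V}

/-- Two vertices on different sides of an edge of a tree are joined through that edge. -/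
theorem IsTree.dist_across (hT : T.IsTree) {p q k t : V} (hpq : T.Adj p q)
    (hk : T.dist k p < T.dist k q) (ht : T.dist t q < T.dist t p) :
    T.dist k t = T.dist k p + 1 + T.dist t q := by
  obtain ⟨A, hA, hAl⟩ := hT.1.exists_path_of_dist k p
  obtain ⟨B, hB, hBl⟩ := hT.1.exists_path_of_dist q t
  -- a vertex on both geodesics would be strictly closer to each end of the edge than to the other
  have hdisj : ∀ v, v ∈ A.support → v ∉ B.support := by
    classical
    intro v hvA hvB
    have h1 : T.dist k v + T.dist v p ≤ T.dist k p := by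
      rw [← hAl, ← A.take_spec hvA, SimpleGraph.Walk.length_append]
      exact add_le_add (SimpleGraph.dist_le _) (SimpleGraph.dist_le _)
    have h2 : T.dist q v + T.dist v t ≤ T.dist q t := by
      rw [← hBl, ← B.take_spec hvB, SimpleGraph.Walk.length_append]
      exact add_le_add (SimpleGraph.dist_le _) (SimpleGraph.dist_le _)
    have h3 : T.dist k q ≤ T.dist k v + T.dist v q := hT.1.dist_triangle
    have h4 : T.dist t p ≤ T.dist t v + T.dist v p := hT.1.dist_triangle
    rw [T.dist_comm (u := t) (v := v)] at h4
    rw [T.dist_comm (u := t) (v := q)] at ht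
    rw [T.dist_comm (u := v) (v := q)] at h3
    omega
  have hW : (A.append (SimpleGraph.Walk.cons hpq B)).IsPath := by
    refine SimpleGraph.Walk.isPath_def _ |>.2 ?_
    rw [SimpleGraph.Walk.support_append, SimpleGraph.Walk.support_cons, List.tail_cons,
      List.nodup_append']
    exact ⟨hA.support_nodup, hB.support_nodup, fun v h1 h2 => hdisj v h1 h2⟩
  obtain ⟨C, hC, hCl⟩ := hT.1.exists_path_of_dist k t
  have h' : C = A.append (SimpleGraph.Walk.cons hpq B) :=
    congrArg Subtype.val ((hT.2.subsingleton_path k t).elim ⟨C, hC⟩ ⟨_, hW⟩)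
  rw [← hCl, h', SimpleGraph.Walk.length_append, SimpleGraph.Walk.length_cons, hAl, hBl,
    T.dist_comm (u := q)]
  omega

theorem IsTree.dist_cases (hT : T.IsTree) (v : V) {p q : V} (hpq : T.Adj p q) :
    T.dist v p = T.dist v q + 1 ∨ T.dist v q = T.dist v p + 1 :=
  hT.dist_eq_dist_add_one_of_adj v hpq

theorem IsTree.dist_two (hT : T.IsTree) {i m j : V} (h1 : T.Adj i m) (h2 : T.Adj m j)
    (hij : i ≠ j) : T.dist i j = 2 := by
  have h3 := SimpleGraph.dist_eq_one_iff_adj.2 h1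
  have h4 := hT.1.pos_dist_of_ne hij
  rcases IsTree.dist_cases hT i h2 with h | h <;> omega

/-- A vertex has at most one neighbor that is closer to a given vertex. -/
theorem IsTree.parent_unique (hT : T.IsTree) {k p q r : V} (hq : T.Adj p q) (hr : T.Adj p r)
    (h1 : T.dist k q + 1 = T.dist k p) (h2 : T.dist k r + 1 = T.dist k p) : q = r := by
  by_contra hne
  have h3 := IsTree.dist_two hT hq.symm hr hne
  have h4 := SimpleGraph.dist_eq_one_iff_adj.2 hq.symm
  have h5 := IsTree.dist_across hT hr (k := q) (t := k) (by omega) (by omega)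
  rw [T.dist_comm (u := q) (v := k)] at h5
  omega

theorem exists_parent (hT : T.Connected) {k p : V} (h : k ≠ p) :
    ∃ q, T.Adj p q ∧ T.dist k q + 1 = T.dist k p := by
  obtain ⟨W, hW⟩ := hT.exists_walk_length_eq_dist p k
  cases W with
  | nil => exact absurd rfl h
  | @cons _ q _ hq W' =>
    refine ⟨q, hq, ?_⟩
    rw [SimpleGraph.Walk.length_cons, T.dist_comm] at hW
    have h1 := SimpleGraph.dist_le W'
    rw [T.dist_comm] at h1
    have h2 : T.dist k p ≤ T.dist k q + T.dist q p := hT.dist_triangle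
    have h3 := SimpleGraph.dist_eq_one_iff_adj.2 hq.symm
    omega

theorem exists_middle (hT : T.Connected) {i j : V} (h : T.dist i j = 2) :
    ∃ m, T.Adj i m ∧ T.Adj m j := by
  obtain ⟨m, hm, h1⟩ := exists_parent hT (k := i) (p := j) (by rintro rfl; simp at h)
  exact ⟨m, SimpleGraph.dist_eq_one_iff_adj.1 (by omega), hm.symm⟩

theorem IsTree.middle_unique (hT : T.IsTree) {i m m' j : V} (hij : i ≠ j) (h1 : T.Adj i m)
    (h2 : T.Adj m j) (h3 : T.Adj i m') (h4 : T.Adj m' j) : m = m' := by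
  have h := IsTree.dist_two hT h1 h2 hij
  have h5 := SimpleGraph.dist_eq_one_iff_adj.2 h1
  have h6 := SimpleGraph.dist_eq_one_iff_adj.2 h3
  exact IsTree.parent_unique hT (k := i) h2.symm h4.symm (by omega) (by omega)

/-- Extending a geodesic by an edge that does not turn back. -/
theorem IsTree.dist_extend (hT : T.IsTree) {k p q r : V} (hq : T.Adj q p) (hr : T.Adj p r)
    (h : T.dist k q + 1 = T.dist k p) (hne : q ≠ r) : T.dist k r = T.dist k p + 1 := by
  rcases IsTree.dist_cases hT k hr with h1 | h1
  · exact absurd (IsTree.parent_unique hT hq.symm hr h (by omega)) hne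
  · exact h1

/-- If `j` lies behind the edge `i - a` and at distance at least two from `i`, every vertex other
than `i` within two hops of `j` lies behind that edge too. -/
theorem IsTree.toward (hT : T.IsTree) {i a j l : V} (ha : T.Adj i a)
    (hj : T.dist j a + 1 = T.dist j i) (hij : 2 ≤ T.dist j i) (hl : T.dist l j ≤ 2)
    (hne : l ≠ i) : T.dist l a + 1 = T.dist l i := by
  rcases IsTree.dist_cases hT l ha with h | h
  · exact h.symm
  · have h1 := IsTree.dist_across hT ha (k := l) (t := j) (by omega) (by omega)
    have h2 := hT.1.pos_dist_of_ne hne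
    omega

/-- The vertices within distance two of both of two vertices that are at distance at least two
from each other, are at distance at most two from each other. -/
theorem IsTree.near_near (hT : T.IsTree) {i j l m : V} (hij : 2 ≤ T.dist i j)
    (hil : T.dist i l ≤ 2) (hlj : T.dist l j ≤ 2) (him : T.dist i m ≤ 2) (hmj : T.dist m j ≤ 2) :
    T.dist l m ≤ 2 := by
  rw [T.dist_comm] at hij
  obtain ⟨a, ha, hja⟩ := exists_parent hT.1 (k := j) (p := i) (by rintro rfl; simp at hij)
  by_cases hl : l = i
  · rwa [hl]
  by_cases hm : m = i
  · rw [hm, T.dist_comm]; exact hil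
  have h1 := IsTree.toward hT ha hja hij hlj hl
  have h2 := IsTree.toward hT ha hja hij hmj hm
  rw [T.dist_comm] at hil him
  have h3 : T.dist l m ≤ T.dist l a + T.dist a m := hT.1.dist_triangle
  rw [T.dist_comm (u := a)] at h3
  omega

theorem IsTree.near_middle (hT : T.IsTree) {i m j l : V} (h1 : T.Adj i m) (h2 : T.Adj m j)
    (hij : i ≠ j) (hil : T.dist i l ≤ 2) (hlj : T.dist l j ≤ 2) : l = m ∨ T.Adj l m := by
  rcases Nat.lt_or_ge (T.dist l m) 2 with h | h
  · rcases Nat.lt_or_ge (T.dist l m) 1 with h' | h'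
    · exact Or.inl (hT.1.dist_eq_zero_iff.1 (by omega))
    · exact Or.inr (SimpleGraph.dist_eq_one_iff_adj.1 (by omega))
  · exfalso
    rw [T.dist_comm] at hil
    rcases IsTree.dist_cases hT l h1 with h3 | h3
    · omega
    rcases IsTree.dist_cases hT l h2 with h4 | h4
    · exact hij (IsTree.parent_unique hT (k := l) h1.symm h2 (by omega) (by omega))
    · omega

/-- A nonleaf that has a neighbor has a second one. -/
theorem exists_other_neighbor {i a : V} (h : ¬ IsLeaf T i) (ha : T.Adj i a) :
    ∃ c, T.Adj i c ∧ c ≠ a := by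
  by_contra hc
  push Not at hc
  refine h ?_
  have : T.neighborSet i = {a} := by
    ext c
    exact ⟨fun hx => hc c hx, fun hx => by rw [Set.mem_singleton_iff.1 hx]; exact ha⟩
  rw [IsLeaf, this, Set.ncard_singleton]

theorem IsLeaf.eq_of_adj {i a c : V} (h : IsLeaf T i) (ha : T.Adj i a) (hc : T.Adj i c) :
    c = a := by
  obtain ⟨z, hz⟩ := Set.ncard_eq_one.1 h
  have h1 : a ∈ T.neighborSet i := ha
  have h2 : c ∈ T.neighborSet i := hc
  rw [hz] at h1 h2
  exact h2.trans h1.symm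

end Tree

/-! ### The inverse spectral matrix of the uncorrupted process -/

section Precision

variable {V : Type u} {T : SimpleGraph V} {b : V → V → ℝ}

/-- The couplings `b` are nonzero exactly along the edges of `T`. -/
def SupportedOn (T : SimpleGraph V) (b : V → V → ℝ) : Prop :=
  ∀ i j, i ≠ j → (b i j ≠ 0 ↔ T.Adj i j)

theorem SupportedOn.eq_zero (hb : SupportedOn T b) {i j : V} (h : i ≠ j) (h' : ¬ T.Adj i j) :
    b i j = 0 := by
  by_contra h2
  exact h' ((hb i j h).1 h2)

theorem SupportedOn.ne_zero (hb : SupportedOn T b) {i j : V} (h : T.Adj i j) : b i j ≠ 0 :=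
  (hb i j h.ne).2 h

variable [DecidableEq V]

theorem SupportedOn.dist_le_one (hb : SupportedOn T b) {S : V → ℂ} {i j : V}
    (h : netMatrix S b i j ≠ 0) : T.dist i j ≤ 1 := by
  by_cases hij : i = j
  · simp [hij]
  · refine (SimpleGraph.dist_eq_one_iff_adj.2 ?_).le
    by_contra h2
    rw [netMatrix_offdiag S b hij, hb.eq_zero hij h2] at h
    simp at h

variable [Fintype V]

/-- The matrix `(S - B)^* Φ_ww⁻¹ (S - B)` for noise spectra `φ` at one frequency. -/
def precision (S : V → ℂ) (b : V → V → ℝ) (φ : V → ℝ) : Matrix V V ℂ :=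
  (netMatrix S b).conjTranspose * Matrix.diagonal (fun k => ((φ k)⁻¹ : ℂ)) * netMatrix S b

/-- The diagonal of `precision`, as real numbers. -/
def precisionDiag (S : V → ℂ) (b : V → V → ℝ) (φ : V → ℝ) (l : V) : ℝ :=
  ∑ k, Complex.normSq (netMatrix S b k l) * (φ k)⁻¹

theorem precision_apply (S : V → ℂ) (b : V → V → ℝ) (φ : V → ℝ) (i j : V) :
    precision S b φ i j =
      ∑ k, star (netMatrix S b k i) * ((φ k)⁻¹ : ℂ) * netMatrix S b k j := by
  rw [precision, Matrix.mul_apply]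
  simp only [Matrix.mul_diagonal, Matrix.conjTranspose_apply]

theorem precision_diag (S : V → ℂ) (b : V → V → ℝ) (φ : V → ℝ) (l : V) :
    precision S b φ l l = (precisionDiag S b φ l : ℂ) := by
  rw [precision_apply, precisionDiag]
  push_cast
  refine Finset.sum_congr rfl fun k _ => ?_
  rw [Complex.normSq_eq_conj_mul_self, Complex.star_def]
  ring

theorem precisionDiag_nonneg (S : V → ℂ) (b : V → V → ℝ) {φ : V → ℝ} (hφ : ∀ k, 0 < φ k)
    (l : V) : 0 ≤ precisionDiag S b φ l :=
  Finset.sum_nonneg fun k _ => mul_nonneg (Complex.normSq_nonneg _) (inv_nonneg.2 (hφ k).le)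

theorem precisionDiag_pos {S : V → ℂ} (hS : ∀ k, S k ≠ 0) (b : V → V → ℝ) {φ : V → ℝ}
    (hφ : ∀ k, 0 < φ k) (l : V) : 0 < precisionDiag S b φ l :=
  Finset.sum_pos' (fun k _ => mul_nonneg (Complex.normSq_nonneg _) (inv_nonneg.2 (hφ k).le))
    ⟨l, Finset.mem_univ l, by
      rw [netMatrix_diag]
      exact mul_pos (Complex.normSq_pos.2 (hS l)) (inv_pos.2 (hφ l))⟩

theorem sq_lt_precisionDiag {S : V → ℂ} (hS : ∀ k, S k ≠ 0) (b : V → V → ℝ) {φ : V → ℝ}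
    (hφ : ∀ k, 0 < φ k) {m l : V} (hml : m ≠ l) :
    b m l ^ 2 * (φ m)⁻¹ < precisionDiag S b φ l := by
  have h0 : ∀ k, 0 ≤ Complex.normSq (netMatrix S b k l) * (φ k)⁻¹ := fun k =>
    mul_nonneg (Complex.normSq_nonneg _) (inv_nonneg.2 (hφ k).le)
  have h1 := Finset.add_le_sum (s := Finset.univ) (fun k _ => h0 k) (Finset.mem_univ m)
    (Finset.mem_univ l) hml
  have h2 : 0 < Complex.normSq (netMatrix S b l l) * (φ l)⁻¹ := by
    rw [netMatrix_diag]
    exact mul_pos (Complex.normSq_pos.2 (hS l)) (inv_pos.2 (hφ l))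
  have h3 : Complex.normSq (netMatrix S b m l) = b m l ^ 2 := by
    rw [netMatrix_offdiag S b hml, Complex.normSq_neg, Complex.normSq_ofReal, sq]
  rw [h3] at h1
  unfold precisionDiag
  linarith

theorem precision_eq_zero (hT : T.IsTree) (hb : SupportedOn T b) (S : V → ℂ) (φ : V → ℝ)
    {i j : V} (hij : 2 < T.dist i j) : precision S b φ i j = 0 := by
  rw [precision_apply]
  refine Finset.sum_eq_zero fun k _ => ?_
  by_contra h
  have h1 := hb.dist_le_one (right_ne_zero_of_mul h)
  have h2 := hb.dist_le_one (S := S) (i := k) (j := i) fun h0 => h (by simp [h0])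
  have h3 : T.dist i j ≤ T.dist i k + T.dist k j := hT.1.dist_triangle
  rw [T.dist_comm] at h2
  omega

/-- The entry at two nodes with common neighbor `m` comes from the noise at `m` only. -/
theorem precision_two_hop (hT : T.IsTree) (hb : SupportedOn T b) (S : V → ℂ) (φ : V → ℝ)
    {i m j : V} (h1 : T.Adj i m) (h2 : T.Adj m j) (hij : i ≠ j) :
    precision S b φ i j = ((b m i * b m j * (φ m)⁻¹ : ℝ) : ℂ) := by
  have hd := IsTree.dist_two hT h1 h2 hij
  rw [precision_apply, Finset.sum_eq_single m]
  · rw [netMatrix_offdiag S b h1.ne', netMatrix_offdiag S b h2.ne]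
    simp
    ring
  · intro k _ hkm
    by_contra h
    have h3 := hb.dist_le_one (right_ne_zero_of_mul h)
    have h4 := hb.dist_le_one (S := S) (i := k) (j := i) fun h0 => h (by simp [h0])
    have h5 : T.dist i j ≤ T.dist i k + T.dist k j := hT.1.dist_triangle
    rw [T.dist_comm] at h4
    have h6 : T.Adj i k := SimpleGraph.dist_eq_one_iff_adj.1 (by omega)
    have h7 : T.Adj k j := SimpleGraph.dist_eq_one_iff_adj.1 (by omega)
    exact hkm (IsTree.middle_unique hT hij h6 h7 h1 h2)
  · simp

theorem IsGenerativeModel.psd_state_mul_precision {Ω : Type v} [MeasurableSpace Ω]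
    {μ : Measure Ω} [IsProbabilityMeasure μ] {s : V → ℤ → ℝ} {w x : V → ℤ → Ω → ℝ}
    (hm : IsGenerativeModel μ s b w x) (θ : ℝ) :
    psd μ x θ * precision (fun i => dtft (s i) θ) b (fun i => (crossPSD μ (w i) (w i) θ).re) =
      1 := by
  have h := hm.psd_noise θ
  rw [hm.psd_noise_eq_diagonal] at h
  have hpos := fun i => (hm.noise_pos i θ).ne'
  unfold precision
  set φ : V → ℝ := fun i => (crossPSD μ (w i) (w i) θ).re
  set A := netMatrix (fun i => dtft (s i) θ) b
  set Φ := psd μ x θ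
  have h1 : A * (Φ * A.conjTranspose * Matrix.diagonal (fun k => ((φ k)⁻¹ : ℂ))) = 1 := by
    rw [← mul_assoc, ← mul_assoc, ← h, Matrix.diagonal_mul_diagonal]
    rw [← Matrix.diagonal_one]
    congr 1
    ext i
    exact mul_inv_cancel₀ (Complex.ofReal_ne_zero.2 (hpos i))
  rw [← mul_eq_one_comm.1 h1]
  simp only [mul_assoc]

end Precision

/-! ### The inverse spectral matrices of the measurements -/

section Corrected

theorem IsCorruption.h_ne {V : Type u} {Ω : Type v} [MeasurableSpace Ω] {μ : Measure Ω}
    {Y : Set V} {x y : V → ℤ → Ω → ℝ} {h : V → ℝ → ℂ}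
    {d : V → ℝ → ℝ} (hc : IsCorruption μ Y x y h d) (i : V) (θ : ℝ) : h i θ ≠ 0 := by
  by_cases hi : i ∈ Y
  · exact hc.h_ne_zero i hi θ
  · rw [hc.h_clean i hi θ]; exact one_ne_zero

variable {V : Type u} [DecidableEq V] [Fintype V]

/-- The matrix `P - P diag(γ) P`: with `γ` supported on the corrupt nodes, this is the form of the
inverse spectra of the measurements, and of the measurements with the corrupt nodes hidden. -/
def corrected (P : Matrix V V ℂ) (γ : V → ℝ) : Matrix V V ℂ :=
  P - P * Matrix.diagonal (fun l => (γ l : ℂ)) * P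

theorem corrected_apply (P : Matrix V V ℂ) (γ : V → ℝ) (i j : V) :
    corrected P γ i j = P i j - ∑ l, P i l * (γ l : ℂ) * P l j := by
  rw [corrected, Matrix.sub_apply, Matrix.mul_apply]
  simp only [Matrix.mul_diagonal]

/-- The weights `e / (1 + e P_ll)` of the inverse of `P⁻¹ + diag(e)`. -/
def measuredWeight (e ρ : V → ℝ) (l : V) : ℝ := e l / (1 + e l * ρ l)

theorem corrected_mul_add_diagonal {P Φ : Matrix V V ℂ} (hP : P * Φ = 1) {e ρ : V → ℝ}
    (hρ : ∀ l, P l l = (ρ l : ℂ)) (hne : ∀ l, 1 + e l * ρ l ≠ 0)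
    (hP0 : ∀ l m, l ≠ m → e l ≠ 0 → e m ≠ 0 → P l m = 0) :
    corrected P (measuredWeight e ρ) * (Φ + Matrix.diagonal fun l => (e l : ℂ)) = 1 := by
  set γ := measuredWeight e ρ
  have h1 : Matrix.diagonal (fun l => (γ l : ℂ)) * P * Matrix.diagonal (fun l => (e l : ℂ)) =
      Matrix.diagonal fun l => ((γ l * ρ l * e l : ℝ) : ℂ) := by
    ext l m
    rw [Matrix.mul_diagonal, Matrix.diagonal_mul]
    by_cases hlm : l = m
    · subst hlm
      rw [Matrix.diagonal_apply_eq, hρ]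
      push_cast
      ring
    · rw [Matrix.diagonal_apply_ne _ hlm]
      by_cases hl : e l = 0
      · simp [γ, measuredWeight, hl]
      by_cases hm : e m = 0
      · simp [hm]
      simp [hP0 l m hlm hl hm]
  have h2 : Matrix.diagonal (fun l => (e l : ℂ)) - Matrix.diagonal (fun l => (γ l : ℂ)) -
      Matrix.diagonal (fun l => ((γ l * ρ l * e l : ℝ) : ℂ)) = 0 := by
    rw [Matrix.diagonal_sub, Matrix.diagonal_sub, Matrix.diagonal_eq_zero]
    ext l
    have h3 : e l - γ l - γ l * ρ l * e l = 0 := by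
      have := hne l
      simp only [γ, measuredWeight]
      field_simp
      ring
    change (e l : ℂ) - (γ l : ℂ) - ((γ l * ρ l * e l : ℝ) : ℂ) = 0
    exact_mod_cast h3
  set Γ := Matrix.diagonal (fun l => (γ l : ℂ))
  set E := Matrix.diagonal (fun l => (e l : ℂ))
  calc corrected P γ * (Φ + E) = P * Φ + P * (E - Γ * (P * Φ) - Γ * P * E) := by
        unfold corrected
        noncomm_ring
    _ = 1 := by rw [hP, mul_one, h1, h2, mul_zero, add_zero]

variable {Ω : Type v} [MeasurableSpace Ω] {μ : Measure Ω}

theorem IsCorruption.psd_measured {Y : Set V} {x y : V → ℤ → Ω → ℝ} {h : V → ℝ → ℂ}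
    {d : V → ℝ → ℝ} (hc : IsCorruption μ Y x y h d) (θ : ℝ) :
    psd μ y θ = Matrix.diagonal (fun i => h i θ) * psd μ x θ *
      Matrix.diagonal (fun i => star (h i θ)) + Matrix.diagonal fun i => (d i θ : ℂ) := by
  ext i j
  rw [Matrix.add_apply, Matrix.mul_diagonal, Matrix.diagonal_mul]
  by_cases hij : i = j
  · subst hij
    rw [Matrix.diagonal_apply_eq]
    change crossPSD μ (y i) (y i) θ = _ * crossPSD μ (x i) (x i) θ * _ + _
    rw [hc.auto]
    ring
  · rw [Matrix.diagonal_apply_ne _ hij, add_zero]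
    exact hc.cross_distinct i j hij θ

/-- Inverse spectrum of the measurements, provided the entries of `Φ_xx⁻¹` between distinct
corrupt nodes vanish. -/
theorem IsCorruption.invPSD_measured {Y : Set V} {x y : V → ℤ → Ω → ℝ} {h : V → ℝ → ℂ}
    {d : V → ℝ → ℝ} (hc : IsCorruption μ Y x y h d) (θ : ℝ) {P : Matrix V V ℂ}
    (hP : P * psd μ x θ = 1) {ρ : V → ℝ} (hρ : ∀ l, P l l = (ρ l : ℂ)) (hρ0 : ∀ l, 0 ≤ ρ l)
    (hP0 : ∀ l m, l ∈ Y → m ∈ Y → l ≠ m → P l m = 0) (i j : V) :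
    invPSD μ y θ i j =
      corrected P (measuredWeight (fun l => d l θ / Complex.normSq (h l θ)) ρ) i j /
        (star (h i θ) * h j θ) := by
  set e : V → ℝ := fun l => d l θ / Complex.normSq (h l θ)
  have he0 : ∀ l, 0 ≤ e l := fun l => by
    by_cases hl : l ∈ Y
    · exact div_nonneg (hc.d_pos l hl θ).le (Complex.normSq_nonneg _)
    · simp [e, hc.d_clean l hl θ]
  have heY : ∀ l, e l ≠ 0 → l ∈ Y := fun l hl => by
    by_contra h2
    exact hl (by simp [e, hc.d_clean l h2 θ])
  have hM := corrected_mul_add_diagonal hP hρ (e := e)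
    (fun l => by have := mul_nonneg (he0 l) (hρ0 l); positivity)
    (fun l m hlm hl hm => hP0 l m (heY l hl) (heY m hm) hlm)
  set M := corrected P (measuredWeight e ρ)
  have hh := fun i => hc.h_ne i θ
  have hinv : invPSD μ y θ = Matrix.diagonal (fun i => (star (h i θ))⁻¹) * M *
      Matrix.diagonal (fun i => (h i θ)⁻¹) := by
    refine Matrix.inv_eq_left_inv ?_
    have hD : (Matrix.diagonal fun i => (d i θ : ℂ)) = Matrix.diagonal (fun i => h i θ) *
        Matrix.diagonal (fun l => (e l : ℂ)) * Matrix.diagonal (fun i => star (h i θ)) := by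
      rw [Matrix.diagonal_mul_diagonal, Matrix.diagonal_mul_diagonal]
      congr 1
      ext l
      have h1 : (Complex.normSq (h l θ) : ℂ) ≠ 0 :=
        Complex.ofReal_ne_zero.2 (Complex.normSq_pos.2 (hh l)).ne'
      simp only [e]
      push_cast
      rw [mul_right_comm, Complex.star_def, Complex.mul_conj]
      field_simp
    have h1 : Matrix.diagonal (fun i => (h i θ)⁻¹) * Matrix.diagonal (fun i => h i θ) = 1 := by
      rw [Matrix.diagonal_mul_diagonal, ← Matrix.diagonal_one]
      congr 1
      ext l
      exact inv_mul_cancel₀ (hh l)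
    have h2 : Matrix.diagonal (fun i => (star (h i θ))⁻¹) *
        Matrix.diagonal (fun i => star (h i θ)) = 1 := by
      rw [Matrix.diagonal_mul_diagonal, ← Matrix.diagonal_one]
      congr 1
      ext l
      exact inv_mul_cancel₀ (star_ne_zero.2 (hh l))
    rw [hc.psd_measured, hD]
    set H := Matrix.diagonal (fun i => h i θ)
    set H' := Matrix.diagonal (fun i => star (h i θ))
    set K := Matrix.diagonal (fun i => (h i θ)⁻¹)
    set K' := Matrix.diagonal (fun i => (star (h i θ))⁻¹)
    set E := Matrix.diagonal (fun l => (e l : ℂ))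
    calc K' * M * K * (H * psd μ x θ * H' + H * E * H')
        = K' * (M * ((K * H) * (psd μ x θ + E))) * H' := by noncomm_ring
      _ = 1 := by rw [h1, one_mul, hM, mul_one, h2]
  rw [hinv, Matrix.mul_diagonal, Matrix.diagonal_mul, div_eq_mul_inv, mul_inv]
  ring

/-- The weights `1 / P_ll` of the Schur complement that hides the corrupt nodes. -/
def hiddenWeight (Y : Set V) (ρ : V → ℝ) (l : V) : ℝ :=
  open Classical in if l ∈ Y then (ρ l)⁻¹ else 0

theorem IsCorruption.hiddenInvPSD_measured {Y : Set V} {x y : V → ℤ → Ω → ℝ} {h : V → ℝ → ℂ}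
    {d : V → ℝ → ℝ} (hc : IsCorruption μ Y x y h d) (θ : ℝ) {P : Matrix V V ℂ}
    (hP : P * psd μ x θ = 1) {ρ : V → ℝ} (hρ : ∀ l, P l l = (ρ l : ℂ)) (hρ0 : ∀ l, 0 < ρ l)
    (hP0 : ∀ l m, l ∈ Y → m ∈ Y → l ≠ m → P l m = 0) (i j : {i : V // i ∉ Y}) :
    hiddenInvPSD μ y Y θ i j = corrected P (hiddenWeight Y ρ) i.1 j.1 := by
  classical
  set M := corrected P (hiddenWeight Y ρ)
  have hw : ∀ l, l ∉ Y → hiddenWeight Y ρ l = 0 := fun l hl => by simp [hiddenWeight, hl]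
  have hw' : ∀ l ∈ Y, (hiddenWeight Y ρ l : ℂ) * P l l = 1 := fun l hl => by
    rw [hρ, hiddenWeight, if_pos hl]
    exact_mod_cast inv_mul_cancel₀ (hρ0 l).ne'
  -- the columns of the corrupt nodes vanish
  have hcol : ∀ i, ∀ l ∈ Y, M i l = 0 := fun i l hl => by
    simp only [M, corrected_apply]
    rw [Finset.sum_eq_single l, mul_assoc, hw' l hl, mul_one, sub_self]
    · intro m _ hm
      by_cases hmY : m ∈ Y
      · rw [hP0 m l hmY hl hm, mul_zero]
      · simp [hw m hmY]
    · simp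
  have hMΦ : ∀ i k, k ∉ Y → (M * psd μ x θ) i k = (1 : Matrix V V ℂ) i k := fun i k hk => by
    simp only [M, corrected]
    rw [sub_mul, mul_assoc, mul_assoc, hP, mul_one, Matrix.sub_apply, Matrix.mul_diagonal, hw k hk]
    simp
  have hclean : ∀ i k : {i : V // i ∉ Y}, psd μ (fun i : {i : V // i ∉ Y} => y i.1) θ i k =
      psd μ x θ i.1 k.1 := fun i k => by
    have h1 : psd μ y θ i.1 k.1 = psd μ x θ i.1 k.1 := by
      rw [hc.psd_measured, Matrix.add_apply, Matrix.mul_diagonal, Matrix.diagonal_mul,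
        Matrix.diagonal_apply]
      simp [hc.h_clean _ i.2, hc.h_clean _ k.2, hc.d_clean _ i.2]
    exact h1
  have hinv : hiddenInvPSD μ y Y θ = M.submatrix Subtype.val Subtype.val := by
    refine Matrix.inv_eq_left_inv ?_
    ext i k
    rw [Matrix.mul_apply]
    simp only [Matrix.submatrix_apply, hclean]
    have h1 := hMΦ i.1 k.1 k.2
    rw [Matrix.mul_apply] at h1
    have h2 : ∀ j ∈ Finset.univ, M i.1 j * psd μ x θ j k.1 ≠ 0 → j ∉ Y := fun j _ hj hjY =>
      hj (by rw [hcol i.1 j hjY, zero_mul])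
    rw [← Finset.sum_filter_of_ne h2, Finset.sum_subtype (p := fun j => j ∉ Y) _ (by simp)] at h1
    rw [h1, Matrix.one_apply, Matrix.one_apply]
    simp only [Subtype.ext_iff]
  rw [hinv, Matrix.submatrix_apply]

end Corrected

/-! ### Phases -/

theorem HasConstantPhase.of_real {f : ℝ → ℂ} {c : ℝ} {r : ℝ → ℝ} (hr : ∀ θ, 0 < r θ)
    (hf : ∀ θ, f θ = ((c * r θ : ℝ) : ℂ)) : HasConstantPhase f := by
  refine ⟨(c : ℂ).arg, fun θ _ _ => ?_⟩
  rw [hf, mul_comm, Complex.ofReal_mul, Complex.arg_real_mul _ (hr θ)]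

/-- A conjugate-symmetric function of constant phase is real: at `θ` and `-θ` its phases are
opposite. -/
theorem HasConstantPhase.im_eq_zero {f : ℝ → ℂ} (h : HasConstantPhase f)
    (hs : ∀ θ, f (-θ) = star (f θ)) (hp : f (-Real.pi) = f Real.pi) {θ : ℝ}
    (hθ : θ ∈ Set.Ioc (-Real.pi) Real.pi) : (f θ).im = 0 := by
  by_cases hπ : θ = Real.pi
  · rw [hs] at hp
    exact hπ ▸ Complex.conj_eq_iff_im.1 hp
  by_cases h0 : f θ = 0
  · simp [h0]
  obtain ⟨c, hc⟩ := h
  have h1 := hc θ hθ h0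
  have h2 := hc (-θ) ⟨by linarith [lt_of_le_of_ne hθ.2 hπ], by linarith [hθ.1]⟩
    (by rw [hs]; exact star_ne_zero.2 h0)
  rw [hs, ← h1, Complex.star_def, Complex.arg_conj] at h2
  split_ifs at h2 with h3
  · exact (Complex.arg_eq_pi_iff.1 h3).2
  · have h4 : (f θ).arg = 0 := by linarith
    exact (Complex.arg_eq_zero_iff.1 h4).2

section Symmetry

variable {Ω : Type v} [MeasurableSpace Ω] {ι : Type u} [Fintype ι] [DecidableEq ι]

theorem invPSD_neg (μ : Measure Ω) (X : ι → ℤ → Ω → ℝ) (θ : ℝ) (i j : ι) :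
    invPSD μ X (-θ) i j = star (invPSD μ X θ i j) := by
  have h : psd μ X (-θ) = ((psd μ X θ).conjTranspose).transpose := by
    ext i j
    exact dtft_neg _ θ
  rw [invPSD, h, ← Matrix.transpose_nonsing_inv, ← Matrix.conjTranspose_nonsing_inv]
  rfl

theorem invPSD_neg_pi (μ : Measure Ω) (X : ι → ℤ → Ω → ℝ) :
    invPSD μ X (-Real.pi) = invPSD μ X Real.pi := by
  have h : psd μ X (-Real.pi) = psd μ X Real.pi := by
    ext i j
    exact dtft_neg_pi _
  rw [invPSD, h, invPSD]

theorem not_hasConstantPhase_invPSD {μ : Measure Ω} {X : ι → ℤ → Ω → ℝ} {i j : ι}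
    (h : ∃ θ ∈ Set.Ioc (-Real.pi) Real.pi, (invPSD μ X θ i j).im ≠ 0) :
    ¬ HasConstantPhase fun θ => invPSD μ X θ i j := by
  obtain ⟨θ, hθ, hne⟩ := h
  exact fun hc => hne (hc.im_eq_zero (fun θ => invPSD_neg μ X θ i j)
    (by simp only [invPSD_neg_pi]) hθ)

end Symmetry

/-! ### Entries of the corrected inverse spectra -/

section Pointwise

variable {V : Type u} [DecidableEq V] [Fintype V] {T : SimpleGraph V} {Y : Set V}
  {b : V → V → ℝ} {γ : V → ℝ}

/-- Only one corrupt node contributes to the correction of an entry at nonadjacent nodes. -/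
theorem corrected_of_near (hT : T.IsTree) (hb : SupportedOn T b) (hY : IsDeep T Y) (S : V → ℂ)
    (φ : V → ℝ) (hγ : ∀ l, l ∉ Y → γ l = 0) {i j l : V} (hl : l ∈ Y) (hij : 2 ≤ T.dist i j)
    (hil : T.dist i l ≤ 2) (hlj : T.dist l j ≤ 2) :
    corrected (precision S b φ) γ i j =
      precision S b φ i j - precision S b φ i l * (γ l : ℂ) * precision S b φ l j := by
  rw [corrected_apply, Finset.sum_eq_single l _ (by simp)]
  intro m _ hm
  by_cases hmY : m ∈ Y
  · by_cases h1 : T.dist i m ≤ 2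
    · by_cases h2 : T.dist m j ≤ 2
      · have h3 := IsTree.near_near hT hij hil hlj h1 h2
        have h4 := hY.apart l hl m hmY hm.symm
        omega
      · rw [precision_eq_zero hT hb S φ (not_le.1 h2), mul_zero]
    · rw [precision_eq_zero hT hb S φ (not_le.1 h1), zero_mul, zero_mul]
  · simp [hγ m hmY]

theorem corrected_of_not_near (hT : T.IsTree) (hb : SupportedOn T b) (S : V → ℂ)
    (φ : V → ℝ) (hγ : ∀ l, l ∉ Y → γ l = 0) {i j : V}
    (h : ∀ l ∈ Y, T.dist i l ≤ 2 → ¬ T.dist l j ≤ 2) :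
    corrected (precision S b φ) γ i j = precision S b φ i j := by
  rw [corrected_apply, Finset.sum_eq_zero, sub_zero]
  intro l _
  by_cases hl : l ∈ Y
  · by_cases h1 : T.dist i l ≤ 2
    · rw [precision_eq_zero hT hb S φ (not_le.1 (h l hl h1)), mul_zero]
    · rw [precision_eq_zero hT hb S φ (not_le.1 h1), zero_mul, zero_mul]
  · simp [hγ l hl]

theorem corrected_corrupt_left (hT : T.IsTree) (hb : SupportedOn T b) (hY : IsDeep T Y)
    (S : V → ℂ) (φ : V → ℝ) (hγ : ∀ l, l ∉ Y → γ l = 0) {l : V} (hl : l ∈ Y) (j : V) :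
    corrected (precision S b φ) γ l j =
      precision S b φ l j * ((1 - γ l * precisionDiag S b φ l : ℝ) : ℂ) := by
  rw [corrected_apply, Finset.sum_eq_single l _ (by simp), precision_diag]
  · push_cast; ring
  intro m _ hm
  by_cases hmY : m ∈ Y
  · have h4 := hY.apart l hl m hmY hm.symm
    rw [precision_eq_zero hT hb S φ (by omega), zero_mul, zero_mul]
  · simp [hγ m hmY]

theorem corrected_corrupt_right (hT : T.IsTree) (hb : SupportedOn T b) (hY : IsDeep T Y)
    (S : V → ℂ) (φ : V → ℝ) (hγ : ∀ l, l ∉ Y → γ l = 0) {l : V} (hl : l ∈ Y) (j : V) :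
    corrected (precision S b φ) γ j l =
      precision S b φ j l * ((1 - γ l * precisionDiag S b φ l : ℝ) : ℂ) := by
  rw [corrected_apply, Finset.sum_eq_single l _ (by simp), precision_diag]
  · push_cast; ring
  intro m _ hm
  by_cases hmY : m ∈ Y
  · have h4 := hY.apart m hmY l hl hm
    rw [precision_eq_zero hT hb S φ (i := m) (by omega), mul_zero]
  · simp [hγ m hmY]

theorem star_precision (S : V → ℂ) (b : V → V → ℝ) (φ : V → ℝ) (i j : V) :
    star (precision S b φ i j) = precision S b φ j i := by
  simp only [precision_apply, star_sum, star_mul', star_star]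
  refine Finset.sum_congr rfl fun k _ => ?_
  simp
  ring

theorem star_corrected_precision (S : V → ℂ) (b : V → V → ℝ) (φ γ : V → ℝ) (i j : V) :
    star (corrected (precision S b φ) γ i j) = corrected (precision S b φ) γ j i := by
  simp only [corrected_apply, star_sub, star_sum, star_mul', star_precision]
  congr 1
  refine Finset.sum_congr rfl fun k _ => ?_
  simp
  ring

theorem precision_two_hop_ne_zero (hT : T.IsTree) (hb : SupportedOn T b) (S : V → ℂ)
    {φ : V → ℝ} (hφ : ∀ k, 0 < φ k) {i j : V} (h : T.dist i j = 2) :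
    precision S b φ i j ≠ 0 := by
  obtain ⟨m, h1, h2⟩ := exists_middle hT.1 h
  rw [precision_two_hop hT hb S φ h1 h2 (by rintro rfl; simp at h)]
  exact Complex.ofReal_ne_zero.2 (mul_ne_zero (mul_ne_zero (hb.ne_zero h1.symm) (hb.ne_zero h2))
    (inv_pos.2 (hφ m)).ne')

end Pointwise

section Families

/-- Two nodes are near if they are within two hops of each other, or of a common corrupt node. -/
def Near {V : Type u} (T : SimpleGraph V) (Y : Set V) (i j : V) : Prop :=
  T.dist i j ≤ 2 ∨ ∃ l ∈ Y, T.dist i l ≤ 2 ∧ T.dist l j ≤ 2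

theorem IsDeep.near_iff {V : Type u} {T : SimpleGraph V} {Y : Set V} (hY : IsDeep T Y) {l j : V}
    (hl : l ∈ Y) : Near T Y l j ↔ T.dist l j ≤ 2 := by
  refine ⟨fun h => ?_, Or.inl⟩
  rcases h with h | ⟨m, hm, h1, h2⟩
  · exact h
  · by_cases hlm : l = m
    · rwa [hlm]
    · have := hY.apart l hl m hm hlm
      omega

theorem Near.symm {V : Type u} {T : SimpleGraph V} {Y : Set V} {i j : V} (h : Near T Y i j) : Near T Y j i := by
  rcases h with h | ⟨l, hl, h1, h2⟩
  · exact Or.inl (by rwa [T.dist_comm])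
  · exact Or.inr ⟨l, hl, by rwa [T.dist_comm], by rwa [T.dist_comm]⟩

variable {V : Type u} [DecidableEq V] [Fintype V]

/-- A tree network with its spectral data as functions of the frequency, and with the
nondegeneracy conditions on the uncorrupted system: the filter responses `S`, couplings `b`
supported on `T`, noise spectra `φ`, and set `Y` of corrupt nodes. -/
structure TreeNetwork (T : SimpleGraph V) (Y : Set V) (b : V → V → ℝ) (S : ℝ → V → ℂ)
    (φ : ℝ → V → ℝ) : Prop where
  tree : T.IsTree
  supp : SupportedOn T b
  deep : IsDeep T Y
  filter_ne : ∀ θ k, S θ k ≠ 0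
  noise_pos : ∀ θ k, 0 < φ θ k
  edge : ∀ i j, T.Adj i j →
    ∃ θ ∈ Set.Ioc (-Real.pi) Real.pi, (precision (S θ) b (φ θ) i j).im ≠ 0
  corner : ∀ l ∈ Y, ∀ q r, T.Adj q l → T.Adj l r → q ≠ r →
    ∃ θ ∈ Set.Ioc (-Real.pi) Real.pi,
      (precision (S θ) b (φ θ) q l * precision (S θ) b (φ θ) l r).im ≠ 0

/-- Admissible weights `γ` for the correction by the corrupt nodes. -/
structure IsWeight (Y : Set V) (b : V → V → ℝ) (S : ℝ → V → ℂ) (φ : ℝ → V → ℝ)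
    (γ : ℝ → V → ℝ) : Prop where
  off : ∀ θ l, l ∉ Y → γ θ l = 0
  pos : ∀ θ, ∀ l ∈ Y, 0 < γ θ l
  le : ∀ θ, ∀ l ∈ Y, γ θ l * precisionDiag (S θ) b (φ θ) l ≤ 1

variable {T : SimpleGraph V} {Y : Set V} {b : V → V → ℝ} {S : ℝ → V → ℂ} {φ : ℝ → V → ℝ}
  {γ : ℝ → V → ℝ}

theorem zero_mem_Ioc_pi : (0 : ℝ) ∈ Set.Ioc (-Real.pi) Real.pi :=
  ⟨by linarith [Real.pi_pos], Real.pi_pos.le⟩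

theorem TreeNetwork.exists_precision_ne_zero (hN : TreeNetwork T Y b S φ) {i j : V}
    (hij : i ≠ j) (h : T.dist i j ≤ 2) :
    ∃ θ ∈ Set.Ioc (-Real.pi) Real.pi, precision (S θ) b (φ θ) i j ≠ 0 := by
  have h0 := hN.tree.1.pos_dist_of_ne hij
  rcases (by omega : T.dist i j = 1 ∨ T.dist i j = 2) with h1 | h1
  · obtain ⟨θ, hθ, h2⟩ := hN.edge i j (SimpleGraph.dist_eq_one_iff_adj.1 h1)
    exact ⟨θ, hθ, fun h3 => h2 (by simp [h3])⟩
  · exact ⟨0, zero_mem_Ioc_pi, precision_two_hop_ne_zero hN.tree hN.supp _ (hN.noise_pos 0) h1⟩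

/-- Two neighbors of a corrupt node: the corrected entry is not real. -/
theorem TreeNetwork.corrected_corner (hN : TreeNetwork T Y b S φ) (hγ : IsWeight Y b S φ γ)
    {i l j : V} (hl : l ∈ Y) (h1 : T.Adj i l) (h2 : T.Adj l j) (hij : i ≠ j) :
    ∃ θ ∈ Set.Ioc (-Real.pi) Real.pi,
      (corrected (precision (S θ) b (φ θ)) (γ θ) i j).im ≠ 0 := by
  obtain ⟨θ, hθ, h3⟩ := hN.corner l hl i j h1 h2 hij
  refine ⟨θ, hθ, ?_⟩
  rw [corrected_of_near hN.tree hN.supp hN.deep _ _ (hγ.off θ) hl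
    (IsTree.dist_two hN.tree h1 h2 hij).ge (by rw [SimpleGraph.dist_eq_one_iff_adj.2 h1]; norm_num)
    (by rw [SimpleGraph.dist_eq_one_iff_adj.2 h2]; norm_num),
    precision_two_hop hN.tree hN.supp _ _ h1 h2 hij, Complex.sub_im, Complex.ofReal_im, zero_sub,
    mul_right_comm, Complex.im_mul_ofReal]
  exact neg_ne_zero.2 (mul_ne_zero h3 (hγ.pos θ l hl).ne')

theorem TreeNetwork.corrected_ne_zero_iff (hN : TreeNetwork T Y b S φ) (hγ : IsWeight Y b S φ γ)
    (hedge : ∀ i j, i ∉ Y → j ∉ Y → T.Adj i j → ∃ θ ∈ Set.Ioc (-Real.pi) Real.pi,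
      corrected (precision (S θ) b (φ θ)) (γ θ) i j ≠ 0)
    {i j : V} (hi : i ∉ Y) (hj : j ∉ Y) (hij : i ≠ j) :
    (∃ θ ∈ Set.Ioc (-Real.pi) Real.pi,
      corrected (precision (S θ) b (φ θ)) (γ θ) i j ≠ 0) ↔ Near T Y i j := by
  have hT := hN.tree
  constructor
  · rintro ⟨θ, hθ, h⟩
    by_contra hn
    rw [Near] at hn
    push Not at hn
    refine h ?_
    rw [corrected_of_not_near hT hN.supp _ _ (hγ.off θ)
      (fun l hl h1 => not_le.2 (hn.2 l hl h1)), precision_eq_zero hT hN.supp _ _ hn.1]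
  intro hn
  have h0 := hT.1.pos_dist_of_ne hij
  by_cases h1 : T.dist i j = 1
  · exact hedge i j hi hj (SimpleGraph.dist_eq_one_iff_adj.1 h1)
  have h2 : 2 ≤ T.dist i j := by omega
  by_cases hl : ∃ l ∈ Y, T.dist i l ≤ 2 ∧ T.dist l j ≤ 2
  · obtain ⟨l, hl, hil, hlj⟩ := hl
    have hli : l ≠ i := fun h => hi (h ▸ hl)
    have hlj' : l ≠ j := fun h => hj (h ▸ hl)
    by_cases h3 : T.dist i j = 2
    · obtain ⟨m, hm1, hm2⟩ := exists_middle hT.1 h3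
      rcases IsTree.near_middle hT hm1 hm2 hij hil hlj with rfl | hlm
      · obtain ⟨θ, hθ, h4⟩ := hN.corrected_corner hγ hl hm1 hm2 hij
        exact ⟨θ, hθ, fun h5 => h4 (by simp [h5])⟩
      · -- the correction only reduces the two-hop entry by a factor less than one
        refine ⟨0, zero_mem_Ioc_pi, ?_⟩
        have hφ := inv_pos.2 (hN.noise_pos 0 m)
        rw [corrected_of_near hT hN.supp hN.deep _ _ (hγ.off 0) hl h2 hil hlj,
          precision_two_hop hT hN.supp _ _ hm1 hm2 hij,
          precision_two_hop hT hN.supp _ _ hm1 hlm.symm hli.symm,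
          precision_two_hop hT hN.supp _ _ hlm hm2 hlj']
        have h5 := sq_lt_precisionDiag (hN.filter_ne 0) b (hN.noise_pos 0) hlm.ne'
        have h6 := hγ.le 0 l hl
        have h7 := mul_lt_mul_of_pos_left h5 (hγ.pos 0 l hl)
        have h8 : (b m i * b m j * (φ 0 m)⁻¹) *
            (1 - γ 0 l * (b m l ^ 2 * (φ 0 m)⁻¹)) ≠ 0 :=
          mul_ne_zero (mul_ne_zero (mul_ne_zero (hN.supp.ne_zero hm1.symm) (hN.supp.ne_zero hm2))
            hφ.ne') (by linarith)
        rw [← Complex.ofReal_mul, ← Complex.ofReal_mul, ← Complex.ofReal_sub,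
          Complex.ofReal_ne_zero]
        convert h8 using 1
        ring
    · -- one of the two factors is a two-hop entry, which vanishes nowhere
      have h4 : T.dist i j ≤ T.dist i l + T.dist l j := hT.1.dist_triangle
      have h5 : ∃ θ ∈ Set.Ioc (-Real.pi) Real.pi,
          precision (S θ) b (φ θ) i l ≠ 0 ∧ precision (S θ) b (φ θ) l j ≠ 0 := by
        rcases (by omega : T.dist i l = 2 ∨ T.dist l j = 2) with h6 | h6
        · obtain ⟨θ, hθ, h7⟩ := hN.exists_precision_ne_zero hlj' hlj
          exact ⟨θ, hθ, precision_two_hop_ne_zero hT hN.supp _ (hN.noise_pos θ) h6, h7⟩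
        · obtain ⟨θ, hθ, h7⟩ := hN.exists_precision_ne_zero hli.symm hil
          exact ⟨θ, hθ, h7, precision_two_hop_ne_zero hT hN.supp _ (hN.noise_pos θ) h6⟩
      obtain ⟨θ, hθ, h7, h8⟩ := h5
      refine ⟨θ, hθ, ?_⟩
      rw [corrected_of_near hT hN.supp hN.deep _ _ (hγ.off θ) hl h2 hil hlj,
        precision_eq_zero hT hN.supp _ _ (by omega), zero_sub]
      exact neg_ne_zero.2 (mul_ne_zero (mul_ne_zero h7
        (Complex.ofReal_ne_zero.2 (hγ.pos θ l hl).ne')) h8)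
  · have h3 : T.dist i j ≤ 2 := hn.resolve_right hl
    push Not at hl
    obtain ⟨θ, hθ, h4⟩ := hN.exists_precision_ne_zero hij h3
    refine ⟨θ, hθ, ?_⟩
    rwa [corrected_of_not_near hT hN.supp _ _ (hγ.off θ) (fun l hY h1 => not_le.2 (hl l hY h1))]

/-- A chain `p - l - r - t` with `l` corrupt: the corrected entry at its ends is not real. -/
theorem TreeNetwork.corrected_chain (hN : TreeNetwork T Y b S φ) (hγ : IsWeight Y b S φ γ)
    {p l r t : V} (hl : l ∈ Y) (h1 : T.Adj p l) (h2 : T.Adj l r) (h3 : T.Adj r t) (hpr : p ≠ r)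
    (hlt : l ≠ t) :
    ∃ θ ∈ Set.Ioc (-Real.pi) Real.pi,
      (corrected (precision (S θ) b (φ θ)) (γ θ) p t).im ≠ 0 := by
  have hT := hN.tree
  obtain ⟨θ, hθ, h4⟩ := hN.edge p l h1
  have hpl := SimpleGraph.dist_eq_one_iff_adj.2 h1
  have hlt2 := IsTree.dist_two hT h2 h3 hlt
  have hpr2 := IsTree.dist_two hT h1 h2 hpr
  have hpt := IsTree.dist_extend hT (k := p) h2 h3 (by omega) hlt
  refine ⟨θ, hθ, ?_⟩
  rw [corrected_of_near hT hN.supp hN.deep _ _ (hγ.off θ) hl (by omega) (by omega) (by omega),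
    precision_eq_zero hT hN.supp _ _ (by omega), precision_two_hop hT hN.supp _ _ h2 h3 hlt,
    zero_sub, Complex.neg_im, Complex.im_mul_ofReal, Complex.im_mul_ofReal]
  exact neg_ne_zero.2 (mul_ne_zero (mul_ne_zero h4 (hγ.pos θ l hl).ne')
    (mul_ne_zero (mul_ne_zero (hN.supp.ne_zero h2.symm) (hN.supp.ne_zero h3))
      (inv_pos.2 (hN.noise_pos θ r)).ne'))

/-- A chain `p - q - l - r - t` with `l` corrupt: the corrected entry at its ends has constant
phase, being the product of two two-hop entries. -/
theorem TreeNetwork.corrected_long_chain (hN : TreeNetwork T Y b S φ)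
    (hγ : IsWeight Y b S φ γ) {p q l r t : V} (hl : l ∈ Y) (h0 : T.Adj p q) (h1 : T.Adj q l)
    (h2 : T.Adj l r) (h3 : T.Adj r t) (hpl : p ≠ l) (hqr : q ≠ r) (hlt : l ≠ t) :
    HasConstantPhase fun θ => corrected (precision (S θ) b (φ θ)) (γ θ) p t := by
  have hT := hN.tree
  have hpl2 := IsTree.dist_two hT h0 h1 hpl
  have hpq := SimpleGraph.dist_eq_one_iff_adj.2 h0
  have hlt2 := IsTree.dist_two hT h2 h3 hlt
  have hpr := IsTree.dist_extend hT (k := p) h1 h2 (by omega) hqr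
  have hpt := IsTree.dist_extend hT (k := p) h2 h3 (by omega) hlt
  refine HasConstantPhase.of_real (c := -(b q p * b q l * b r l * b r t))
    (r := fun θ => γ θ l * (φ θ q)⁻¹ * (φ θ r)⁻¹) (fun θ => mul_pos (mul_pos (hγ.pos θ l hl)
    (inv_pos.2 (hN.noise_pos θ q))) (inv_pos.2 (hN.noise_pos θ r))) fun θ => ?_
  rw [corrected_of_near hT hN.supp hN.deep _ _ (hγ.off θ) hl (by omega) (by omega) (by omega),
    precision_eq_zero hT hN.supp _ _ (by omega), precision_two_hop hT hN.supp _ _ h2 h3 hlt,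
    precision_two_hop hT hN.supp _ _ h0 h1 hpl]
  push_cast
  ring

end Families

/-! ### What the measurements reveal about the tree -/

section Location

variable {V : Type u} {T : SimpleGraph V} {Y : Set V}

theorem IsDeep.not_leaf (hY : IsDeep T Y) {l : V} (hl : l ∈ Y) : ¬ IsLeaf T l := fun h => by
  have := hY.leaf l hl l h
  simp at this

theorem IsDeep.notMem_of_near (hY : IsDeep T Y) {l j : V} (hl : l ∈ Y) (hlj : l ≠ j)
    (h : T.dist l j ≤ 2) : j ∉ Y := fun hj => by
  have := hY.apart l hl j hj hlj
  omega

theorem HasTwoHop.exists_adj (h2 : HasTwoHop T) (hT : T.IsTree) (i : V) : ∃ a, T.Adj i a := by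
  obtain ⟨j, hj⟩ := h2 i
  obtain ⟨m, hm, -⟩ := exists_middle hT.1 hj
  exact ⟨m, hm⟩

end Location

/-- The properties of an inverse spectrum `Θ` of the measurements from which the tree is
reconstructed. -/
structure RevealsTree {V : Type u} (T : SimpleGraph V) (Y : Set V) (Θ : ℝ → Matrix V V ℂ) :
    Prop where
  adj : ∀ i j, (supportGraph Θ).Adj i j ↔ i ≠ j ∧ Near T Y i j
  leaf_phase : ∀ i a, IsLeaf T i → T.Adj i a → ¬ HasConstantPhase fun θ => Θ θ i a
  sibling_phase : ∀ i m j, IsLeaf T i → T.Adj i m → T.Adj m j → i ≠ j →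
    HasConstantPhase fun θ => Θ θ i j
  corrupt_phase : ∀ l ∈ Y, 2 ≤ (phaseEdges Θ l).ncard
  corner_phase : ∀ l ∈ Y, ∀ q r, T.Adj q l → T.Adj l r → q ≠ r →
    ¬ HasConstantPhase fun θ => Θ θ q r
  chain_phase : ∀ l ∈ Y, ∀ p r t, T.Adj p l → T.Adj l r → T.Adj r t → p ≠ r → l ≠ t →
    ¬ (HasConstantPhase fun θ => Θ θ p t) ∧ ¬ HasConstantPhase fun θ => Θ θ t p
  long_chain_phase : ∀ l ∈ Y, ∀ p q r t, T.Adj p q → T.Adj q l → T.Adj l r → T.Adj r t →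
    p ≠ l → q ≠ r → l ≠ t → HasConstantPhase fun θ => Θ θ p t

section Model

variable {V : Type u} [DecidableEq V] [Fintype V] {Ω : Type v} [MeasurableSpace Ω]
  {μ : Measure Ω} {T : SimpleGraph V} {Y : Set V} {b : V → V → ℝ} {S : ℝ → V → ℂ}
  {φ : ℝ → V → ℝ} {x y : V → ℤ → Ω → ℝ} {h : V → ℝ → ℂ} {d : V → ℝ → ℝ}

/-- The weights of the correction that the corrupt measurements bring to `Φ_xx⁻¹`. -/
def noiseWeight (b : V → V → ℝ) (S : ℝ → V → ℂ) (φ : ℝ → V → ℝ) (h : V → ℝ → ℂ) (d : V → ℝ → ℝ)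
    (θ : ℝ) : V → ℝ :=
  measuredWeight (fun l => d l θ / Complex.normSq (h l θ)) (precisionDiag (S θ) b (φ θ))

theorem noiseWeight_mul_lt_one (hφ : ∀ θ k, 0 < φ θ k) (hc : IsCorruption μ Y x y h d) {l : V}
    (hl : l ∈ Y) (θ : ℝ) :
    noiseWeight b S φ h d θ l * precisionDiag (S θ) b (φ θ) l < 1 := by
  have h1 : 0 < d l θ / Complex.normSq (h l θ) :=
    div_pos (hc.d_pos l hl θ) (Complex.normSq_pos.2 (hc.h_ne_zero l hl θ))
  have h2 := mul_nonneg h1.le (precisionDiag_nonneg (S θ) b (hφ θ) l)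
  rw [noiseWeight, measuredWeight, div_mul_eq_mul_div, div_lt_one (by linarith)]
  linarith

theorem isWeight_noiseWeight (hφ : ∀ θ k, 0 < φ θ k) (hc : IsCorruption μ Y x y h d) :
    IsWeight Y b S φ (noiseWeight b S φ h d) where
  off θ l hl := by simp [noiseWeight, measuredWeight, hc.d_clean l hl θ]
  pos θ l hl := by
    have h1 : 0 < d l θ / Complex.normSq (h l θ) :=
      div_pos (hc.d_pos l hl θ) (Complex.normSq_pos.2 (hc.h_ne_zero l hl θ))
    have h2 := mul_nonneg h1.le (precisionDiag_nonneg (S θ) b (hφ θ) l)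
    exact div_pos h1 (by linarith)
  le θ l hl := (noiseWeight_mul_lt_one hφ hc hl θ).le

theorem isWeight_hiddenWeight (hS : ∀ θ k, S θ k ≠ 0) (hφ : ∀ θ k, 0 < φ θ k) :
    IsWeight Y b S φ fun θ => hiddenWeight Y (precisionDiag (S θ) b (φ θ)) where
  off θ l hl := by simp [hiddenWeight, hl]
  pos θ l hl := by
    rw [hiddenWeight, if_pos hl]
    exact inv_pos.2 (precisionDiag_pos (hS θ) b (hφ θ) l)
  le θ l hl := by
    rw [hiddenWeight, if_pos hl, inv_mul_cancel₀ (precisionDiag_pos (hS θ) b (hφ θ) l).ne']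

theorem invPSD_eq_corrected (hT : T.IsTree) (hb : SupportedOn T b) (hY : IsDeep T Y)
    (hφ : ∀ θ k, 0 < φ θ k) (hc : IsCorruption μ Y x y h d)
    (hP : ∀ θ, psd μ x θ * precision (S θ) b (φ θ) = 1) (θ : ℝ) (i j : V) :
    invPSD μ y θ i j =
      corrected (precision (S θ) b (φ θ)) (noiseWeight b S φ h d θ) i j /
        (star (h i θ) * h j θ) :=
  hc.invPSD_measured θ (mul_eq_one_comm.1 (hP θ)) (precision_diag _ _ _)
    (precisionDiag_nonneg _ _ (hφ θ)) (fun l m hl hm hlm =>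
      precision_eq_zero hT hb _ _ (by have := hY.apart l hl m hm hlm; omega)) i j

theorem invPSD_clean (hT : T.IsTree) (hb : SupportedOn T b) (hY : IsDeep T Y)
    (hφ : ∀ θ k, 0 < φ θ k) (hc : IsCorruption μ Y x y h d)
    (hP : ∀ θ, psd μ x θ * precision (S θ) b (φ θ) = 1) (θ : ℝ) {i j : V} (hi : i ∉ Y)
    (hj : j ∉ Y) :
    invPSD μ y θ i j = corrected (precision (S θ) b (φ θ)) (noiseWeight b S φ h d θ) i j := by
  rw [invPSD_eq_corrected hT hb hY hφ hc hP, hc.h_clean i hi, hc.h_clean j hj]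
  simp

theorem hiddenInvPSD_eq_corrected (hT : T.IsTree) (hb : SupportedOn T b) (hY : IsDeep T Y)
    (hS : ∀ θ k, S θ k ≠ 0) (hφ : ∀ θ k, 0 < φ θ k) (hc : IsCorruption μ Y x y h d)
    (hP : ∀ θ, psd μ x θ * precision (S θ) b (φ θ) = 1) (θ : ℝ) (i j : {i : V // i ∉ Y}) :
    hiddenInvPSD μ y Y θ i j = corrected (precision (S θ) b (φ θ))
      (hiddenWeight Y (precisionDiag (S θ) b (φ θ))) i.1 j.1 :=
  hc.hiddenInvPSD_measured θ (mul_eq_one_comm.1 (hP θ)) (precision_diag _ _ _)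
    (precisionDiag_pos (hS θ) _ (hφ θ)) (fun l m hl hm hlm =>
      precision_eq_zero hT hb _ _ (by have := hY.apart l hl m hm hlm; omega)) i j

theorem supportGraph_adj_of_iff {ι : Type*} {Θ : ℝ → Matrix ι ι ℂ} {R : ι → ι → Prop}
    (hR : ∀ i j, R i j → R j i)
    (h : ∀ i j, i ≠ j → ((∃ θ ∈ Set.Ioc (-Real.pi) Real.pi, Θ θ i j ≠ 0) ↔ R i j)) (i j : ι) :
    (supportGraph Θ).Adj i j ↔ i ≠ j ∧ R i j := by
  rw [supportGraph, SimpleGraph.fromRel_adj]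
  refine and_congr_right fun hij => ?_
  rw [h i j hij, h j i hij.symm]
  exact ⟨fun h => h.elim id (hR j i), Or.inl⟩

theorem TreeNetwork.hidden_adj_iff (hN : TreeNetwork T Y b S φ)
    (hc : IsCorruption μ Y x y h d)
    (hP : ∀ θ, psd μ x θ * precision (S θ) b (φ θ) = 1)
    (hnd : ∀ i j : {i : V // i ∉ Y}, T.Adj i.1 j.1 →
      ∃ θ ∈ Set.Ioc (-Real.pi) Real.pi, hiddenInvPSD μ y Y θ i j ≠ 0)
    (p q : {i : V // i ∉ Y}) :
    (supportGraph (hiddenInvPSD μ y Y)).Adj p q ↔ p ≠ q ∧ Near T Y p.1 q.1 := by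
  have hM := hiddenInvPSD_eq_corrected hN.tree hN.supp hN.deep hN.filter_ne hN.noise_pos hc hP
  simp only [hM] at hnd
  refine supportGraph_adj_of_iff (R := fun p q : {i : V // i ∉ Y} => Near T Y p.1 q.1)
    (fun _ _ h => h.symm) (fun i j hij => ?_) p q
  simp only [hM]
  exact hN.corrected_ne_zero_iff (isWeight_hiddenWeight hN.filter_ne hN.noise_pos)
    (fun i j hi hj hij => hnd ⟨i, hi⟩ ⟨j, hj⟩ hij) i.2 j.2 fun h => hij (Subtype.ext h)

theorem TreeNetwork.exists_invPSD_ne_zero_iff (hN : TreeNetwork T Y b S φ)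
    (hc : IsCorruption μ Y x y h d)
    (hP : ∀ θ, psd μ x θ * precision (S θ) b (φ θ) = 1)
    (hnd : ∀ i j, i ∉ Y → j ∉ Y → T.Adj i j →
      ∃ θ ∈ Set.Ioc (-Real.pi) Real.pi, invPSD μ y θ i j ≠ 0) {i j : V} (hij : i ≠ j) :
    (∃ θ ∈ Set.Ioc (-Real.pi) Real.pi, invPSD μ y θ i j ≠ 0) ↔ Near T Y i j := by
  have hM := invPSD_eq_corrected hN.tree hN.supp hN.deep hN.noise_pos hc hP
  have hγ := isWeight_noiseWeight (b := b) (S := S) hN.noise_pos hc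
  have hne : ∀ θ i j, invPSD μ y θ i j ≠ 0 ↔
      corrected (precision (S θ) b (φ θ)) (noiseWeight b S φ h d θ) i j ≠ 0 := fun θ i j => by
    rw [hM, div_ne_zero_iff]
    exact and_iff_left (mul_ne_zero (star_ne_zero.2 (hc.h_ne i θ)) (hc.h_ne j θ))
  simp only [hne] at hnd ⊢
  have hfac : ∀ θ, ∀ l ∈ Y, ((1 - noiseWeight b S φ h d θ l *
      precisionDiag (S θ) b (φ θ) l : ℝ) : ℂ) ≠ 0 := fun θ l hl =>
    Complex.ofReal_ne_zero.2
      (sub_pos.2 (noiseWeight_mul_lt_one (b := b) (S := S) hN.noise_pos hc hl θ)).ne'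
  have hprec : (∃ θ ∈ Set.Ioc (-Real.pi) Real.pi, precision (S θ) b (φ θ) i j ≠ 0) ↔
      T.dist i j ≤ 2 := by
    refine ⟨fun ⟨θ, _, h1⟩ => ?_, hN.exists_precision_ne_zero hij⟩
    by_contra h2
    exact h1 (precision_eq_zero hN.tree hN.supp _ _ (not_le.1 h2))
  by_cases hi : i ∈ Y
  · rw [hN.deep.near_iff hi, ← hprec]
    refine exists_congr fun θ => and_congr_right fun _ => ?_
    rw [corrected_corrupt_left hN.tree hN.supp hN.deep _ _ (hγ.off θ) hi, mul_ne_zero_iff]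
    exact and_iff_left (hfac θ i hi)
  by_cases hj : j ∈ Y
  · rw [show Near T Y i j ↔ Near T Y j i from ⟨Near.symm, Near.symm⟩, hN.deep.near_iff hj,
      T.dist_comm, ← hprec]
    refine exists_congr fun θ => and_congr_right fun _ => ?_
    rw [corrected_corrupt_right hN.tree hN.supp hN.deep _ _ (hγ.off θ) hj, mul_ne_zero_iff]
    exact and_iff_left (hfac θ j hj)
  exact hN.corrected_ne_zero_iff hγ hnd hi hj hij

/-- A corrupt node has two edges of nonconstant phase. If its transfer `h` is real, these are the
edges to its neighbors; otherwise, two of the edges to its two-hop neighbors, whose entries in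
`Φ_xx⁻¹` are real. -/
theorem TreeNetwork.two_le_phaseEdges (hN : TreeNetwork T Y b S φ)
    (hc : IsCorruption μ Y x y h d)
    (hP : ∀ θ, psd μ x θ * precision (S θ) b (φ θ) = 1) (h2 : HasTwoHop T)
    (hadj : ∀ i j, (supportGraph (invPSD μ y)).Adj i j ↔ i ≠ j ∧ Near T Y i j)
    {l : V} (hl : l ∈ Y) : 2 ≤ (phaseEdges (invPSD μ y) l).ncard := by
  have hT := hN.tree
  have hγ := isWeight_noiseWeight (b := b) (S := S) hN.noise_pos hc
  have hval : ∀ θ j, j ∉ Y → invPSD μ y θ l j = precision (S θ) b (φ θ) l j *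
      ((1 - noiseWeight b S φ h d θ l * precisionDiag (S θ) b (φ θ) l : ℝ) : ℂ) /
        star (h l θ) := fun θ j hj => by
    rw [invPSD_eq_corrected hT hN.supp hN.deep hN.noise_pos hc hP,
      corrected_corrupt_left hT hN.supp hN.deep _ _ (hγ.off θ) hl, hc.h_clean j hj, mul_one]
  have hfac : ∀ θ, (1 - noiseWeight b S φ h d θ l * precisionDiag (S θ) b (φ θ) l) ≠ 0 :=
    fun θ => (sub_pos.2 (noiseWeight_mul_lt_one (b := b) (S := S) hN.noise_pos hc hl θ)).ne'
  have key : ∀ a c, a ≠ c → l ≠ a → l ≠ c → T.dist l a ≤ 2 → T.dist l c ≤ 2 →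
      (∃ θ ∈ Set.Ioc (-Real.pi) Real.pi, (invPSD μ y θ l a).im ≠ 0) →
      (∃ θ ∈ Set.Ioc (-Real.pi) Real.pi, (invPSD μ y θ l c).im ≠ 0) →
      2 ≤ (phaseEdges (invPSD μ y) l).ncard := by
    intro a c hac hla hlc hda hdc ha hcc
    refine (Set.one_lt_ncard (Set.toFinite _)).2 ⟨s(l, a), ?_, s(l, c), ?_, ?_⟩
    · exact ⟨a, (hadj l a).2 ⟨hla, Or.inl hda⟩, not_hasConstantPhase_invPSD ha, rfl⟩
    · exact ⟨c, (hadj l c).2 ⟨hlc, Or.inl hdc⟩, not_hasConstantPhase_invPSD hcc, rfl⟩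
    · intro he
      exact hac (Sym2.congr_right.1 he)
  obtain ⟨a, ha⟩ := h2.exists_adj hT l
  obtain ⟨c, hca, hne⟩ := exists_other_neighbor (hN.deep.not_leaf hl) ha
  have hda := SimpleGraph.dist_eq_one_iff_adj.2 ha
  have hdc := SimpleGraph.dist_eq_one_iff_adj.2 hca
  by_cases hreal : ∀ θ ∈ Set.Ioc (-Real.pi) Real.pi, (h l θ).im = 0
  · have hone : ∀ a, T.Adj l a →
        ∃ θ ∈ Set.Ioc (-Real.pi) Real.pi, (invPSD μ y θ l a).im ≠ 0 := by
      intro a ha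
      obtain ⟨θ, hθ, h3⟩ := hN.edge l a ha
      refine ⟨θ, hθ, ?_⟩
      have h5 := SimpleGraph.dist_eq_one_iff_adj.2 ha
      have h4 : star (h l θ) = ((h l θ).re : ℂ) := by
        rw [Complex.star_def, Complex.conj_eq_iff_im.2 (hreal θ hθ)]
        exact Complex.ext rfl (hreal θ hθ)
      have h6 : (h l θ).re ≠ 0 := fun h7 => hc.h_ne l θ (Complex.ext h7 (hreal θ hθ))
      rw [hval θ a (hN.deep.notMem_of_near hl ha.ne (by omega)), h4, Complex.div_ofReal_im,
        Complex.im_mul_ofReal]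
      exact div_ne_zero (mul_ne_zero h3 (hfac θ)) h6
    exact key a c hne.symm ha.ne hca.ne (by omega) (by omega) (hone a ha) (hone c hca)
  · push Not at hreal
    obtain ⟨θ, hθ, h3⟩ := hreal
    have htwo : ∀ m j, T.Adj l m → T.Adj m j → l ≠ j →
        ∃ θ ∈ Set.Ioc (-Real.pi) Real.pi, (invPSD μ y θ l j).im ≠ 0 := by
      intro m j hm hj hlj
      refine ⟨θ, hθ, ?_⟩
      have h5 := IsTree.dist_two hT hm hj hlj
      rw [hval θ j (hN.deep.notMem_of_near hl hlj (by omega)),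
        precision_two_hop hT hN.supp _ _ hm hj hlj, ← Complex.ofReal_mul, div_eq_mul_inv,
        Complex.im_ofReal_mul, Complex.inv_im, Complex.star_def, Complex.conj_im, neg_neg]
      refine mul_ne_zero (mul_ne_zero (mul_ne_zero (mul_ne_zero (hN.supp.ne_zero hm.symm)
        (hN.supp.ne_zero hj)) (inv_pos.2 (hN.noise_pos θ m)).ne') (hfac θ)) (div_ne_zero h3 ?_)
      rw [Complex.normSq_conj]
      exact (Complex.normSq_pos.2 (hc.h_ne l θ)).ne'
    have hleaf : ∀ a, T.Adj l a → ∃ a', T.Adj a a' ∧ a' ≠ l := fun a ha =>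
      exists_other_neighbor (fun h4 => by
        have h5 := hN.deep.leaf l hl a h4
        have h6 := SimpleGraph.dist_eq_one_iff_adj.2 ha
        omega) ha.symm
    obtain ⟨a', ha', hal⟩ := hleaf a ha
    obtain ⟨c', hc', hcl⟩ := hleaf c hca
    refine key a' c' ?_ hal.symm hcl.symm (IsTree.dist_two hT ha ha' hal.symm).le
      (IsTree.dist_two hT hca hc' hcl.symm).le (htwo a a' ha ha' hal.symm)
      (htwo c c' hca hc' hcl.symm)
    rintro rfl
    exact hal (IsTree.middle_unique hT hne.symm ha' hc'.symm ha.symm hca)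

theorem TreeNetwork.revealsTree (hN : TreeNetwork T Y b S φ)
    (hc : IsCorruption μ Y x y h d)
    (hP : ∀ θ, psd μ x θ * precision (S θ) b (φ θ) = 1) (h2 : HasTwoHop T)
    (hnd : ∀ i j, i ∉ Y → j ∉ Y → T.Adj i j →
      ∃ θ ∈ Set.Ioc (-Real.pi) Real.pi, invPSD μ y θ i j ≠ 0) :
    RevealsTree T Y (invPSD μ y) := by
  have hT := hN.tree
  have hY := hN.deep
  have hγ := isWeight_noiseWeight (b := b) (S := S) hN.noise_pos hc
  have hadj := supportGraph_adj_of_iff (R := Near T Y) (Θ := invPSD μ y) (fun _ _ h => h.symm)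
    (fun i j => hN.exists_invPSD_ne_zero_iff hc hP hnd)
  have hval := fun θ {i j : V} (hi : i ∉ Y) (hj : j ∉ Y) =>
    invPSD_clean hT hN.supp hY hN.noise_pos hc hP θ hi hj
  have hclean1 : ∀ l ∈ Y, ∀ a, T.Adj l a → a ∉ Y := fun l hl a ha =>
    hY.notMem_of_near hl ha.ne (by rw [SimpleGraph.dist_eq_one_iff_adj.2 ha]; norm_num)
  have hclean2 : ∀ l ∈ Y, ∀ m a, T.Adj l m → T.Adj m a → l ≠ a → a ∉ Y :=
    fun l hl m a hm ha hla => hY.notMem_of_near hl hla (IsTree.dist_two hT hm ha hla).le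
  have hleaf : ∀ i j, IsLeaf T i → T.dist i j ≤ 2 → j ∉ Y := fun i j hi hj hjY => by
    have := hY.leaf j hjY i hi
    rw [T.dist_comm] at this
    omega
  have hleaf' : ∀ i j, IsLeaf T i → T.dist i j ≤ 2 → ∀ θ, invPSD μ y θ i j =
      precision (S θ) b (φ θ) i j := fun i j hi hj θ => by
    rw [hval θ (hleaf i i hi (by simp)) (hleaf i j hi hj),
      corrected_of_not_near hT hN.supp _ _ (hγ.off θ)]
    intro l hl h1
    exact absurd hl (hleaf i l hi h1)
  constructor
  · exact hadj
  · intro i a hi ha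
    obtain ⟨θ, hθ, h3⟩ := hN.edge i a ha
    refine not_hasConstantPhase_invPSD ⟨θ, hθ, ?_⟩
    rwa [hleaf' i a hi (by rw [SimpleGraph.dist_eq_one_iff_adj.2 ha]; norm_num)]
  · intro i m j hi hm hj hij
    simp only [hleaf' i j hi (IsTree.dist_two hT hm hj hij).le]
    refine HasConstantPhase.of_real (c := b m i * b m j) (r := fun θ => (φ θ m)⁻¹)
      (fun θ => inv_pos.2 (hN.noise_pos θ m)) fun θ => ?_
    exact precision_two_hop hT hN.supp _ _ hm hj hij
  · exact fun l hl => hN.two_le_phaseEdges hc hP h2 hadj hl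
  · intro l hl q r hq hr hqr
    obtain ⟨θ, hθ, h3⟩ := hN.corrected_corner hγ hl hq hr hqr
    refine not_hasConstantPhase_invPSD ⟨θ, hθ, ?_⟩
    rwa [hval θ (hclean1 l hl q hq.symm) (hclean1 l hl r hr)]
  · intro l hl p r t hp hr ht hpr hlt
    have hpY := hclean1 l hl p hp.symm
    have htY := hclean2 l hl r t hr ht hlt
    have h3 : ∃ θ ∈ Set.Ioc (-Real.pi) Real.pi, (invPSD μ y θ p t).im ≠ 0 := by
      obtain ⟨θ, hθ, h3⟩ := hN.corrected_chain hγ hl hp hr ht hpr hlt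
      exact ⟨θ, hθ, by rwa [hval θ hpY htY]⟩
    refine ⟨not_hasConstantPhase_invPSD h3, ?_⟩
    obtain ⟨θ, hθ, h4⟩ := h3
    refine not_hasConstantPhase_invPSD ⟨θ, hθ, ?_⟩
    rw [hval θ hpY htY] at h4
    rwa [hval θ htY hpY, ← star_corrected_precision, Complex.star_def, Complex.conj_im,
      neg_ne_zero]
  · intro l hl p q r t hp hq hr ht hpl hqr hlt
    simp only [hval _ (hclean2 l hl q p hq.symm hp.symm hpl.symm) (hclean2 l hl r t hr ht hlt)]
    exact hN.corrected_long_chain hγ hl hp hq hr ht hpl hqr hlt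

end Model

/-! ### Detection of the corrupt nodes and the leaves -/

section Detection

variable {V : Type u} {T : SimpleGraph V} {Y : Set V} {Θ : ℝ → Matrix V V ℂ}

theorem IsLeaf.near_iff (hY : IsDeep T Y) {i j : V} (hi : IsLeaf T i) :
    Near T Y i j ↔ T.dist i j ≤ 2 := by
  refine ⟨fun h => ?_, Or.inl⟩
  rcases h with h | ⟨m, hm, h1, -⟩
  · exact h
  · have := hY.leaf m hm i hi
    rw [T.dist_comm] at this
    omega

theorem RevealsTree.isCandidate_of_corrupt (R : RevealsTree T Y Θ) (hY : IsDeep T Y) {l : V}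
    (hl : l ∈ Y) : IsCandidate (supportGraph Θ) l := by
  have h1 : ∀ j ∈ insert l ((supportGraph Θ).neighborSet l), T.dist l j ≤ 2 := by
    rintro j (rfl | hj)
    · simp
    · exact (hY.near_iff hl).1 ((R.adj l j).1 hj).2
  intro j hj k hk hjk
  exact (R.adj j k).2 ⟨hjk, Or.inr ⟨l, hl, by rw [T.dist_comm]; exact h1 j hj, h1 k hk⟩⟩

theorem RevealsTree.isCandidate_of_leaf (R : RevealsTree T Y Θ) (hT : T.IsTree)
    (hY : IsDeep T Y) {i a : V} (hi : IsLeaf T i) (ha : T.Adj i a) :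
    IsCandidate (supportGraph Θ) i := by
  have h1 : ∀ j ∈ insert i ((supportGraph Θ).neighborSet i), T.dist j a ≤ 1 := by
    rintro j (rfl | hj)
    · exact (SimpleGraph.dist_eq_one_iff_adj.2 ha).le
    · have h2 := (hi.near_iff hY).1 ((R.adj i j).1 hj).2
      have h3 := hT.1.pos_dist_of_ne ((R.adj i j).1 hj).1
      rcases (by omega : T.dist i j = 1 ∨ T.dist i j = 2) with h4 | h4
      · rw [hi.eq_of_adj ha (SimpleGraph.dist_eq_one_iff_adj.1 h4)]
        simp
      · obtain ⟨m, hm, hmj⟩ := exists_middle hT.1 h4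
        rw [hi.eq_of_adj ha hm] at hmj
        exact (SimpleGraph.dist_eq_one_iff_adj.2 hmj.symm).le
  intro j hj k hk hjk
  refine (R.adj j k).2 ⟨hjk, Or.inl ?_⟩
  have h2 : T.dist j k ≤ T.dist j a + T.dist a k := hT.1.dist_triangle
  have h3 := h1 j hj
  have h4 := h1 k hk
  rw [T.dist_comm] at h4
  omega

/-- The neighborhood of a clean nonleaf `i` is not a clique: take a path `e - i - a - c`. The ends
are adjacent only if `a` is corrupt; then `e` is not a leaf, and a further neighbor of `e` is not
adjacent to `a`. -/
theorem RevealsTree.isCandidate_iff (R : RevealsTree T Y Θ) (hT : T.IsTree)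
    (h2 : HasTwoHop T) (hY : IsDeep T Y) (i : V) :
    IsCandidate (supportGraph Θ) i ↔ i ∈ Y ∨ IsLeaf T i := by
  constructor
  · intro hcand
    by_contra hcon
    push Not at hcon
    obtain ⟨hiY, hleaf⟩ := hcon
    have hmem : ∀ j, i ≠ j → T.dist i j ≤ 2 →
        j ∈ insert i ((supportGraph Θ).neighborSet i) := fun j hij hj =>
      Set.mem_insert_of_mem _ ((R.adj i j).2 ⟨hij, Or.inl hj⟩)
    obtain ⟨c, hc⟩ := h2 i
    obtain ⟨a, hia, hac⟩ := exists_middle hT.1 hc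
    obtain ⟨e, hie, hea⟩ := exists_other_neighbor hleaf hia
    have hic : i ≠ c := by rintro rfl; simp at hc
    have d1 := SimpleGraph.dist_eq_one_iff_adj.2 hie
    have d1' := SimpleGraph.dist_eq_one_iff_adj.2 hie.symm
    have d2 := SimpleGraph.dist_eq_one_iff_adj.2 hia
    have d3 : T.dist c a = 1 := SimpleGraph.dist_eq_one_iff_adj.2 hac.symm
    have d4 := IsTree.dist_two hT hie.symm hia hea
    have d5 := IsTree.dist_extend hT (k := e) hia hac (by omega) hic
    have hec : e ≠ c := by rintro rfl; simp at d5
    have hnear := ((R.adj e c).1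
      (hcand (hmem e hie.ne (by omega)) (hmem c hic hc.le) hec)).2
    obtain ⟨l, hl, hel, hlc⟩ := hnear.resolve_left (by omega)
    have hle : l ≠ e := by rintro rfl; omega
    have hlc' : l ≠ c := by rintro rfl; omega
    rw [T.dist_comm] at hel
    have e1 := IsTree.toward hT hie.symm (j := c) (l := l)
      (by rw [T.dist_comm (u := c), T.dist_comm (u := c)]; omega)
      (by rw [T.dist_comm (u := c)]; omega) hlc hle
    have e2 := IsTree.toward hT hac.symm (j := e) (l := l) (by omega) (by omega) hel hlc'
    have haY : a ∈ Y := by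
      rcases IsTree.dist_cases hT l hia with h | h
      · have : l = a := hT.1.dist_eq_zero_iff.1 (by omega)
        exact this ▸ hl
      · have : l = i := hT.1.dist_eq_zero_iff.1 (by omega)
        exact absurd (this ▸ hl) hiY
    have heleaf : ¬ IsLeaf T e := fun h => by
      have := hY.leaf a haY e h
      rw [T.dist_comm] at this
      omega
    obtain ⟨f, hef, hfi⟩ := exists_other_neighbor heleaf hie.symm
    have d6 := IsTree.dist_two hT hia.symm hie hea.symm
    have d7 : T.dist a i = 1 := SimpleGraph.dist_eq_one_iff_adj.2 hia.symm
    have d8 := IsTree.dist_extend hT (k := a) hie hef (by omega) hfi.symm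
    have d9 := IsTree.dist_two hT hie hef hfi.symm
    have haf : a ≠ f := by rintro rfl; simp at d8
    have hnear2 := ((R.adj a f).1
      (hcand (hmem a hia.ne (by omega)) (hmem f hfi.symm d9.le) haf)).2
    have := (hY.near_iff haY).1 hnear2
    omega
  · rintro (hi | hi)
    · exact R.isCandidate_of_corrupt hY hi
    · obtain ⟨a, ha⟩ := h2.exists_adj hT i
      exact R.isCandidate_of_leaf hT hY hi ha

theorem RevealsTree.phaseEdges_leaf (R : RevealsTree T Y Θ) (hT : T.IsTree)
    (hY : IsDeep T Y) {i a : V} (hi : IsLeaf T i) (ha : T.Adj i a) :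
    phaseEdges Θ i = {s(i, a)} := by
  ext e
  constructor
  · rintro ⟨j, hj, hph, rfl⟩
    have h2 := (hi.near_iff hY).1 ((R.adj i j).1 hj).2
    have hij := ((R.adj i j).1 hj).1
    have h3 := hT.1.pos_dist_of_ne hij
    rcases (by omega : T.dist i j = 1 ∨ T.dist i j = 2) with h4 | h4
    · rw [hi.eq_of_adj ha (SimpleGraph.dist_eq_one_iff_adj.1 h4)]
      rfl
    · obtain ⟨m, hm, hmj⟩ := exists_middle hT.1 h4
      exact absurd (R.sibling_phase i m j hi hm hmj hij) hph
  · intro he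
    rw [Set.mem_singleton_iff] at he
    subst he
    have h1 := SimpleGraph.dist_eq_one_iff_adj.2 ha
    exact ⟨a, (R.adj i a).2 ⟨ha.ne, Or.inl (by omega)⟩, R.leaf_phase i a hi ha, rfl⟩

/-- The correct output of the detection algorithm. -/
def trueDetection (T : SimpleGraph V) (Y : Set V) : Detection V where
  corrupt := Y
  leaves := {i | IsLeaf T i}
  leafEdges := {e | e ∈ T.edgeSet ∧ ∃ i ∈ e, IsLeaf T i}

theorem RevealsTree.detect_eq [Fintype V] [DecidableEq V] {Ω : Type v} [MeasurableSpace Ω]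
    {μ : Measure Ω} {y : V → ℤ → Ω → ℝ} (R : RevealsTree T Y (invPSD μ y)) (hT : T.IsTree)
    (h2 : HasTwoHop T) (hY : IsDeep T Y) : detect μ y = trueDetection T Y := by
  have hcand := R.isCandidate_iff hT h2 hY
  have hleaf : ∀ i, IsLeaf T i → ¬ 2 ≤ (phaseEdges (invPSD μ y) i).ncard := fun i hi => by
    obtain ⟨a, ha⟩ := h2.exists_adj hT i
    rw [R.phaseEdges_leaf hT hY hi ha, Set.ncard_singleton]
    norm_num
  have hL : ∀ i, (IsCandidate (supportGraph (invPSD μ y)) i ∧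
      ¬ 2 ≤ (phaseEdges (invPSD μ y) i).ncard) ↔ IsLeaf T i := fun i =>
    ⟨fun h => ((hcand i).1 h.1).resolve_left fun hi => h.2 (R.corrupt_phase i hi),
      fun h => ⟨(hcand i).2 (Or.inr h), hleaf i h⟩⟩
  unfold detect trueDetection
  congr 1
  · ext i
    exact ⟨fun h => ((hcand i).1 h.1).resolve_right fun hi => hleaf i hi h.2,
      fun h => ⟨(hcand i).2 (Or.inl h), R.corrupt_phase i h⟩⟩
  · ext i
    exact hL i
  · ext e
    simp only [Set.mem_ofPred_eq, ← and_assoc, hL]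
    constructor
    · rintro ⟨i, hi, he⟩
      obtain ⟨a, ha⟩ := h2.exists_adj hT i
      rw [R.phaseEdges_leaf hT hY hi ha, Set.mem_singleton_iff] at he
      rw [he]
      exact ⟨ha, i, Sym2.mem_mk_left i a, hi⟩
    · rintro ⟨he, i, hie, hi⟩
      refine ⟨i, hi, ?_⟩
      obtain ⟨a, rfl⟩ := Sym2.mem_iff_exists.1 hie
      rw [R.phaseEdges_leaf hT hY hi he]
      rfl

end Detection

/-! ### Separation in the graph with the corrupt nodes hidden -/

section Separation

variable {V : Type u} {T : SimpleGraph V} {Y : Set V}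

/-- Nodes on the two sides of an edge with clean ends, other than these ends, are not near. -/
theorem not_near_across (hT : T.IsTree) {p q k t : V} (hp : p ∉ Y) (hq : q ∉ Y)
    (hpq : T.Adj p q) (hk : T.dist k p < T.dist k q) (hkp : k ≠ p)
    (ht : T.dist t q < T.dist t p) (htq : t ≠ q) : ¬ Near T Y k t := by
  have h1 := hT.1.pos_dist_of_ne hkp
  have h2 := hT.1.pos_dist_of_ne htq
  rintro (h | ⟨l, hl, hkl, hlt⟩)
  · have := IsTree.dist_across hT hpq hk ht
    omega
  · rcases IsTree.dist_cases hT l hpq with h | h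
    · have h3 := IsTree.dist_across hT hpq hk (t := l) (by omega)
      have h4 := hT.1.pos_dist_of_ne (u := l) (v := q) (by rintro rfl; exact hq hl)
      omega
    · have h3 := IsTree.dist_across hT hpq (k := l) (by omega) ht
      have h4 := hT.1.pos_dist_of_ne (u := l) (v := p) (by rintro rfl; exact hp hl)
      omega

theorem exists_clean_side (hT : T.IsTree) (hY : IsDeep T Y) {p q : V} (hpl : ¬ IsLeaf T p)
    (hpq : T.Adj p q) : ∃ k, k ∉ Y ∧ T.dist k p < T.dist k q ∧ k ≠ p := by
  obtain ⟨a, ha, haq⟩ := exists_other_neighbor hpl hpq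
  have h1 := SimpleGraph.dist_eq_one_iff_adj.2 ha.symm
  have h2 := IsTree.dist_two hT ha.symm hpq haq
  by_cases haY : a ∈ Y
  · obtain ⟨c, hc, hcp⟩ := exists_other_neighbor (hY.not_leaf haY) ha.symm
    have h3 := SimpleGraph.dist_eq_one_iff_adj.2 hc
    have h4 := IsTree.dist_two hT hc.symm ha.symm hcp
    have h5 : T.dist c a = 1 := SimpleGraph.dist_eq_one_iff_adj.2 hc.symm
    have h6 := IsTree.dist_extend hT (k := c) ha.symm hpq (by omega) haq
    exact ⟨c, hY.notMem_of_near haY hc.ne (by omega), by omega, hcp⟩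
  · exact ⟨a, haY, by omega, ha.ne'⟩

variable {A : SimpleGraph {i : V // i ∉ Y}}

theorem exists_separated (hT : T.IsTree) (hY : IsDeep T Y)
    (hA : ∀ p q, A.Adj p q ↔ p ≠ q ∧ Near T Y p.1 q.1) {p q : {i : V // i ∉ Y}}
    (hp : ¬ IsLeaf T p.1) (hq : ¬ IsLeaf T q.1) (hpq : T.Adj p.1 q.1) :
    ∃ K S : Set {i : V // i ∉ Y}, K.Nonempty ∧ S.Nonempty ∧ Separates A K S {p, q} := by
  obtain ⟨k, hkY, hk1, hk2⟩ := exists_clean_side hT hY hp hpq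
  obtain ⟨t, htY, ht1, ht2⟩ := exists_clean_side hT hY hq hpq.symm
  refine ⟨{k | T.dist k.1 p.1 < T.dist k.1 q.1 ∧ k ≠ p},
    {t | T.dist t.1 q.1 < T.dist t.1 p.1 ∧ t ≠ q}, ⟨⟨k, hkY⟩, hk1, fun h => hk2 ?_⟩,
    ⟨⟨t, htY⟩, ht1, fun h => ht2 ?_⟩, ?_, ?_, ?_⟩
  · exact congrArg Subtype.val h
  · exact congrArg Subtype.val h
  · rw [Set.disjoint_left]
    rintro z ⟨h1, h2⟩ (rfl | rfl)
    · exact h2 rfl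
    · simp at h1
  · rw [Set.disjoint_left]
    rintro z ⟨h1, h2⟩ (rfl | rfl)
    · simp at h1
    · exact h2 rfl
  · rintro k hk t ht W
    induction W with
    | nil => exact absurd hk.1 (not_lt.2 ht.1.le)
    | @cons k k' t hkk W ih =>
      by_cases h1 : k' ∈ ({p, q} : Set {i : V // i ∉ Y})
      · exact ⟨k', h1, by simp⟩
      rw [Set.mem_insert_iff, Set.mem_singleton_iff, not_or] at h1
      rcases IsTree.dist_cases hT k'.1 hpq with h | h
      · exact absurd ((hA _ _).1 hkk).2 (not_near_across hT p.2 q.2 hpq hk.1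
          (fun h => hk.2 (Subtype.ext h)) (by omega) fun h => h1.2 (Subtype.ext h))
      · obtain ⟨z, hz, hzW⟩ := ih ⟨by omega, h1.1⟩ ht
        exact ⟨z, hz, by simp [hzW]⟩

/-- Along the geodesic from `k` to `t`, at most three consecutive nodes are corrupt or in
`{p, q}`, and the next node is near `k`. -/
theorem exists_near_step (hT : T.IsTree) (hY : IsDeep T Y) {p q k t : V}
    (hpq : p ≠ q) (hnadj : ¬ T.Adj p q) (ht : t ∉ Y) (htp : t ≠ p) (htq : t ≠ q) (hkt : t ≠ k) :
    ∃ k', k' ∉ Y ∧ k' ≠ p ∧ k' ≠ q ∧ Near T Y k k' ∧ T.dist t k' < T.dist t k := by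
  have hYY : ∀ u v, u ∈ Y → v ∈ Y → u ≠ v → T.dist u v ≤ 2 → False := fun u v hu hv huv h => by
    have := hY.apart u hu v hv huv
    omega
  have hpq2 : ∀ u v, (u = p ∨ u = q) → (v = p ∨ v = q) → T.Adj u v → False := by
    rintro u v (rfl | rfl) (rfl | rfl) h
    · exact h.ne rfl
    · exact hnadj h
    · exact hnadj h.symm
    · exact h.ne rfl
  have hbad : ∀ v, ¬ (v ∉ Y ∧ v ≠ p ∧ v ≠ q) → v ∈ Y ∨ (v = p ∨ v = q) := fun v h => by tauto
  have hbt : ∀ v, ¬ (v ∉ Y ∧ v ≠ p ∧ v ≠ q) → t ≠ v := by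
    rintro v h rfl
    exact h ⟨ht, htp, htq⟩
  obtain ⟨v1, a1, d1⟩ := exists_parent hT.1 hkt
  have e1 := SimpleGraph.dist_eq_one_iff_adj.2 a1
  by_cases b1 : v1 ∉ Y ∧ v1 ≠ p ∧ v1 ≠ q
  · exact ⟨v1, b1.1, b1.2.1, b1.2.2, Or.inl (by omega), by omega⟩
  obtain ⟨v2, a2, d2⟩ := exists_parent hT.1 (hbt v1 b1)
  have e2 : T.dist k v2 ≤ T.dist k v1 + T.dist v1 v2 := hT.1.dist_triangle
  rw [SimpleGraph.dist_eq_one_iff_adj.2 a2] at e2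
  by_cases b2 : v2 ∉ Y ∧ v2 ≠ p ∧ v2 ≠ q
  · exact ⟨v2, b2.1, b2.2.1, b2.2.2, Or.inl (by omega), by omega⟩
  obtain ⟨v3, a3, d3⟩ := exists_parent hT.1 (hbt v2 b2)
  have e3 : T.dist v1 v3 ≤ T.dist v1 v2 + T.dist v2 v3 := hT.1.dist_triangle
  rw [SimpleGraph.dist_eq_one_iff_adj.2 a2, SimpleGraph.dist_eq_one_iff_adj.2 a3] at e3
  have e12 := SimpleGraph.dist_eq_one_iff_adj.2 a2
  have e23 := SimpleGraph.dist_eq_one_iff_adj.2 a3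
  by_cases b3 : v3 ∉ Y ∧ v3 ≠ p ∧ v3 ≠ q
  · refine ⟨v3, b3.1, b3.2.1, b3.2.2, Or.inr ?_, by omega⟩
    rcases hbad v1 b1 with h1 | h1
    · exact ⟨v1, h1, by omega, by omega⟩
    · rcases hbad v2 b2 with h2 | h2
      · exact ⟨v2, h2, by omega, by omega⟩
      · exact (hpq2 v1 v2 h1 h2 a2).elim
  -- three consecutive dropped nodes: the middle one is corrupt, the outer ones are `p` and `q`
  have h2 : v2 ∈ Y := by
    rcases hbad v2 b2 with h2 | h2
    · exact h2
    · have h1 := (hbad v1 b1).resolve_right fun h => hpq2 v1 v2 h h2 a2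
      have h3 := (hbad v3 b3).resolve_right fun h => hpq2 v2 v3 h2 h a3
      exact (hYY v1 v3 h1 h3 (by rintro rfl; omega) e3).elim
  have h1 := (hbad v1 b1).resolve_left fun h =>
    hYY v1 v2 h h2 (by rintro rfl; omega) (by omega)
  have h3 := (hbad v3 b3).resolve_left fun h =>
    hYY v2 v3 h2 h (by rintro rfl; omega) (by omega)
  obtain ⟨v4, a4, d4⟩ := exists_parent hT.1 (hbt v3 b3)
  have e34 := SimpleGraph.dist_eq_one_iff_adj.2 a4
  have e4 : T.dist v2 v4 ≤ T.dist v2 v3 + T.dist v3 v4 := hT.1.dist_triangle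
  have h13 : v1 ≠ v3 := by rintro rfl; omega
  have h14 : v1 ≠ v4 := by rintro rfl; omega
  have h34 : v3 ≠ v4 := by rintro rfl; omega
  refine ⟨v4, fun h => hYY v2 v4 h2 h (by rintro rfl; omega) (by omega), ?_, ?_,
    Or.inr ⟨v2, h2, by omega, by omega⟩, by omega⟩
  · rcases h1 with h1 | h1 <;> rcases h3 with h3 | h3 <;> grind
  · rcases h1 with h1 | h1 <;> rcases h3 with h3 | h3 <;> grind

/-- Two clean nodes that are not adjacent in the tree do not disconnect the graph inferred with the
corrupt nodes hidden. -/
theorem exists_walk_avoiding (hT : T.IsTree) (hY : IsDeep T Y)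
    (hA : ∀ p q, A.Adj p q ↔ p ≠ q ∧ Near T Y p.1 q.1) {p q : {i : V // i ∉ Y}}
    (hpq : p ≠ q) (hnadj : ¬ T.Adj p.1 q.1) {t : {i : V // i ∉ Y}} (htp : t ≠ p) (htq : t ≠ q)
    (n : ℕ) : ∀ k : {i : V // i ∉ Y}, T.dist t.1 k.1 = n → k ≠ p → k ≠ q →
      ∃ W : A.Walk k t, p ∉ W.support ∧ q ∉ W.support := by
  induction n using Nat.strong_induction_on with
  | _ n ih =>
    intro k hk hkp hkq
    by_cases hkt : t = k
    · subst hkt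
      exact ⟨SimpleGraph.Walk.nil, by simpa using hkp.symm, by simpa using hkq.symm⟩
    obtain ⟨k', hk'Y, hk'p, hk'q, hnear, hd⟩ := exists_near_step hT hY (k := k.1) (t := t.1)
      (fun h => hpq (Subtype.ext h)) hnadj t.2 (fun h => htp (Subtype.ext h))
      (fun h => htq (Subtype.ext h)) (fun h => hkt (Subtype.ext h))
    obtain ⟨W, hW1, hW2⟩ := ih _ (hk ▸ hd) ⟨k', hk'Y⟩ rfl
      (fun h => hk'p (congrArg Subtype.val h)) (fun h => hk'q (congrArg Subtype.val h))
    have hadj : A.Adj k ⟨k', hk'Y⟩ := (hA _ _).2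
      ⟨fun h => by rw [h] at hd; exact lt_irrefl _ hd, hnear⟩
    refine ⟨SimpleGraph.Walk.cons hadj W, ?_, ?_⟩
    · simp [hW1, hkp.symm]
    · simp [hW2, hkq.symm]

theorem adj_of_separates (hT : T.IsTree) (hY : IsDeep T Y)
    (hA : ∀ p q, A.Adj p q ↔ p ≠ q ∧ Near T Y p.1 q.1) {p q : {i : V // i ∉ Y}}
    (hpq : p ≠ q) {K S : Set {i : V // i ∉ Y}} (hK : K.Nonempty) (hS : S.Nonempty)
    (hsep : Separates A K S {p, q}) : T.Adj p.1 q.1 := by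
  by_contra hn
  obtain ⟨k, hk⟩ := hK
  obtain ⟨t, ht⟩ := hS
  have hk' := Set.disjoint_left.1 hsep.1 hk
  have ht' := Set.disjoint_left.1 hsep.2.1 ht
  rw [Set.mem_insert_iff, Set.mem_singleton_iff, not_or] at hk' ht'
  obtain ⟨W, h1, h2⟩ := exists_walk_avoiding hT hY hA hpq hn ht'.1 ht'.2 _ k rfl hk'.1 hk'.2
  obtain ⟨z, rfl | rfl, hzW⟩ := hsep.2.2 k hk t ht W
  · exact h1 hzW
  · exact h2 hzW

end Separation

/-! ### Reconstruction of the tree -/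

section Reconstruction

variable {V : Type u} {T : SimpleGraph V} {Y : Set V} [Fintype V] [DecidableEq V] {Ω : Type v}
  [MeasurableSpace Ω] {μ : Measure Ω} {y : V → ℤ → Ω → ℝ}

theorem observedGraph_adj (hT : T.IsTree) (hY : IsDeep T Y)
    (hA : ∀ p q : {i : V // i ∉ Y},
      (supportGraph (hiddenInvPSD μ y Y)).Adj p q ↔ p ≠ q ∧ Near T Y p.1 q.1)
    (p q : {i : V // i ∉ Y}) :
    (observedGraph μ y (trueDetection T Y)).Adj p q ↔ T.Adj p.1 q.1 := by
  have key : ∀ p q : {i : V // i ∉ Y}, p ≠ q → ((s(p.1, q.1) ∈ (trueDetection T Y).leafEdges ∨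
      (p.1 ∉ (trueDetection T Y).leaves ∧ q.1 ∉ (trueDetection T Y).leaves ∧
      (supportGraph (hiddenInvPSD μ y Y)).Adj p q ∧
      ∃ K S : Set {i : V // i ∉ Y}, K.Nonempty ∧ S.Nonempty ∧
        Separates (supportGraph (hiddenInvPSD μ y Y)) K S {p, q})) ↔ T.Adj p.1 q.1) := by
    intro p q hpq
    constructor
    · rintro (h | ⟨-, -, -, K, S, hK, hS, hsep⟩)
      · exact h.1
      · exact adj_of_separates hT hY hA hpq hK hS hsep
    · intro h
      by_cases hp : IsLeaf T p.1
      · exact Or.inl ⟨h, p.1, Sym2.mem_mk_left _ _, hp⟩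
      by_cases hq : IsLeaf T q.1
      · exact Or.inl ⟨h, q.1, Sym2.mem_mk_right _ _, hq⟩
      · exact Or.inr ⟨hp, hq, (hA p q).2 ⟨hpq, Or.inl (by
          rw [SimpleGraph.dist_eq_one_iff_adj.2 h]; norm_num)⟩, exists_separated hT hY hA hp hq h⟩
  refine (SimpleGraph.fromRel_adj _ p q).trans ?_
  constructor
  · rintro ⟨hpq, h | h⟩
    · exact (key p q hpq).1 h
    · exact ((key q p hpq.symm).1 h).symm
  · intro h
    have hpq : p ≠ q := by rintro rfl; exact h.ne rfl
    exact ⟨hpq, Or.inl ((key p q hpq).2 h)⟩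

/-- Two tree edges in the neighborhood of a corrupt node `l` each have one end at distance one and
one at distance two from `l`. If the ends tested by the phase are not both the far ones, their
entry is not real, so constant phase puts `q` and `r` next to `l`. -/
theorem placed_imp (R : RevealsTree T Y (invPSD μ y)) (hT : T.IsTree) (hY : IsDeep T Y)
    (hO : ∀ p q : {i : V // i ∉ Y},
      (observedGraph μ y (trueDetection T Y)).Adj p q ↔ T.Adj p.1 q.1) {q l r : V}
    (h : Placed μ y (trueDetection T Y) q l r) : T.Adj q l ∧ T.Adj l r := by
  obtain ⟨p', q', r', t', rfl, rfl, hl, hcomp, hpq, htr, hcl, hph⟩ := h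
  change l ∈ Y at hl
  have hpq' := (hO p' q').1 hpq
  have htr' := (hO t' r').1 htr
  have hnear : ∀ a : {i : V // i ∉ Y},
      a.1 ∈ ({p'.1, q'.1, l, r'.1, t'.1} : Set V) → T.dist l a.1 ≤ 2 ∧ 0 < T.dist l a.1 := by
    intro a ha
    have hla : l ≠ a.1 := by rintro rfl; exact a.2 hl
    have hadj := hcl (by simp : l ∈ ({p'.1, q'.1, l, r'.1, t'.1} : Set V)) ha hla
    exact ⟨(hY.near_iff hl).1 ((R.adj l a.1).1 hadj).2, hT.1.pos_dist_of_ne hla⟩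
  have hp := hnear p' (by simp)
  have hq := hnear q' (by simp)
  have hr := hnear r' (by simp)
  have ht := hnear t' (by simp)
  have hone : ∀ a : V, T.dist l a = 1 → T.Adj l a := fun a =>
    SimpleGraph.dist_eq_one_iff_adj.1
  have hlt : ∀ a : {i : V // i ∉ Y}, l ≠ a.1 := by rintro a rfl; exact a.2 hl
  rcases IsTree.dist_cases hT l hpq' with h1 | h1 <;>
    rcases IsTree.dist_cases hT l htr' with h2 | h2
  · exact ⟨(hone _ (by omega)).symm, hone _ (by omega)⟩
  · have hqt : q'.1 ≠ t'.1 := fun h => hcomp (by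
      rw [Subtype.ext h]
      exact SimpleGraph.ConnectedComponent.sound htr.reachable)
    exact absurd hph (R.chain_phase l hl t'.1 q'.1 p'.1 (hone _ (by omega)).symm
      (hone _ (by omega)) hpq'.symm hqt.symm (hlt p')).2
  · have hpr : p'.1 ≠ r'.1 := fun h => hcomp (by
      rw [← Subtype.ext h]
      exact SimpleGraph.ConnectedComponent.sound hpq.symm.reachable)
    exact absurd hph (R.chain_phase l hl p'.1 r'.1 t'.1 (hone _ (by omega)).symm
      (hone _ (by omega)) htr'.symm hpr (hlt t')).1
  · have hpt : p'.1 ≠ t'.1 := fun h => hcomp (by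
      refine SimpleGraph.ConnectedComponent.sound (hpq.symm.reachable.trans ?_)
      rw [Subtype.ext h]
      exact htr.reachable)
    exact absurd hph (R.corner_phase l hl p'.1 t'.1 (hone _ (by omega)).symm
      (hone _ (by omega)) hpt)

theorem exists_placed (R : RevealsTree T Y (invPSD μ y)) (hT : T.IsTree) (hY : IsDeep T Y)
    (hO : ∀ p q : {i : V // i ∉ Y},
      (observedGraph μ y (trueDetection T Y)).Adj p q ↔ T.Adj p.1 q.1) {q l : V}
    (hl : l ∈ Y) (hql : T.Adj q l) : ∃ r, Placed μ y (trueDetection T Y) q l r := by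
  have hnl : ∀ a, T.Adj l a → ¬ IsLeaf T a := fun a ha h => by
    have := hY.leaf l hl a h
    rw [SimpleGraph.dist_eq_one_iff_adj.2 ha] at this
    omega
  obtain ⟨r, hr, hrq⟩ := exists_other_neighbor (hY.not_leaf hl) hql.symm
  obtain ⟨p, hp, hpl⟩ := exists_other_neighbor (hnl q hql.symm) hql
  obtain ⟨t, ht, htl⟩ := exists_other_neighbor (hnl r hr) hr.symm
  have dq := SimpleGraph.dist_eq_one_iff_adj.2 hql.symm
  have dr := SimpleGraph.dist_eq_one_iff_adj.2 hr
  have dp := IsTree.dist_two hT hql.symm hp hpl.symm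
  have dt := IsTree.dist_two hT hr ht htl.symm
  have hqY := hY.notMem_of_near hl hql.ne' (by omega)
  have hrY := hY.notMem_of_near hl hr.ne (by omega)
  have hpY := hY.notMem_of_near hl hpl.symm (by omega)
  have htY := hY.notMem_of_near hl htl.symm (by omega)
  refine ⟨r, ⟨p, hpY⟩, ⟨q, hqY⟩, ⟨r, hrY⟩, ⟨t, htY⟩, rfl, rfl, hl, ?_, (hO _ _).2 hp.symm,
    (hO _ _).2 ht.symm, ?_, R.long_chain_phase l hl p q r t hp.symm hql hr ht hpl hrq.symm
      htl.symm⟩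
  · -- a walk through clean nodes cannot leave the side of `q` of the edge `q - l`
    intro h
    obtain ⟨W⟩ := SimpleGraph.ConnectedComponent.exact h
    have hinv : ∀ a c : {i : V // i ∉ Y}, (observedGraph μ y (trueDetection T Y)).Walk a c →
        T.dist a.1 q < T.dist a.1 l → T.dist c.1 q < T.dist c.1 l := by
      intro a c W
      induction W with
      | nil => exact id
      | @cons a a' c haa W ih =>
        intro ha
        refine ih ?_
        rcases IsTree.dist_cases hT a'.1 hql with h1 | h1
        · have h2 := IsTree.dist_across hT hql ha (t := a'.1) (by omega)
          rw [SimpleGraph.dist_eq_one_iff_adj.2 ((hO _ _).1 haa)] at h2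
          have h3 : a'.1 = l := hT.1.dist_eq_zero_iff.1 (by omega)
          exact absurd hl (h3 ▸ a'.2)
        · omega
    have h1 := hinv _ _ W (by
      change T.dist q q < T.dist q l
      rw [T.dist_comm, SimpleGraph.dist_self, T.dist_comm]; omega)
    have h2 := IsTree.dist_two hT hr.symm hql.symm hrq
    change T.dist r q < T.dist r l at h1
    rw [h2, T.dist_comm] at h1
    omega
  · have hall : ∀ a ∈ ({p, q, l, r, t} : Set V), T.dist l a ≤ 2 := by
      rintro a (rfl | rfl | rfl | rfl | rfl)
      · omega
      · omega
      · simp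
      · omega
      · omega
    intro a ha c hc hac
    exact (R.adj a c).2 ⟨hac, Or.inr ⟨l, hl, by rw [T.dist_comm]; exact hall a ha, hall c hc⟩⟩

theorem hideAndLearn_eq (R : RevealsTree T Y (invPSD μ y)) (hT : T.IsTree) (hY : IsDeep T Y)
    (hA : ∀ p q : {i : V // i ∉ Y},
      (supportGraph (hiddenInvPSD μ y Y)).Adj p q ↔ p ≠ q ∧ Near T Y p.1 q.1) :
    hideAndLearn μ y (trueDetection T Y) = T.edgeSet := by
  have hO := observedGraph_adj (μ := μ) (y := y) hT hY hA
  ext e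
  constructor
  · rintro (⟨p, q, hpq, rfl⟩ | ⟨q, l, r, h, h' | h'⟩)
    · exact (hO p q).1 hpq
    · rw [h']; exact (placed_imp R hT hY hO h).1
    · rw [h']; exact (placed_imp R hT hY hO h).2
  · induction e with
    | _ a c =>
      intro h
      by_cases ha : a ∈ Y
      · obtain ⟨r, hr⟩ := exists_placed R hT hY hO ha (SimpleGraph.Adj.symm h)
        exact Or.inr ⟨c, a, r, hr, Or.inl Sym2.eq_swap⟩
      by_cases hc : c ∈ Y
      · obtain ⟨r, hr⟩ := exists_placed R hT hY hO hc h
        exact Or.inr ⟨a, c, r, hr, Or.inl rfl⟩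
      exact Or.inl ⟨⟨a, ha⟩, ⟨c, hc⟩, (hO _ _).2 h, rfl⟩

end Reconstruction

/-! ### Correctness of the reconstruction for a given network -/

section Correctness

variable {V : Type u} [DecidableEq V] {s : V → ℤ → ℝ} {b : V → V → ℝ}

theorem link_iff (hS : ∀ i θ, dtft (s i) θ ≠ 0) (i j : V) :
    Link s b i j ↔ i ≠ j ∧ b j i ≠ 0 := by
  by_cases hij : i = j
  · simp [Link, transfer, hij]
  · simp [Link, transfer, hij, Ne.symm hij, hS]

theorem supportedOn_topology (hS : ∀ i θ, dtft (s i) θ ≠ 0) (hb : IsBidirected s b) :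
    SupportedOn (topology s b) b := by
  intro i j hij
  rw [topology, SimpleGraph.fromRel_adj]
  constructor
  · intro h
    exact ⟨hij, Or.inr ((link_iff hS j i).2 ⟨hij.symm, h⟩)⟩
  · rintro ⟨-, h | h⟩
    · exact ((link_iff hS j i).1 (hb i j h)).2
    · exact ((link_iff hS j i).1 h).2

variable [Fintype V] {Ω : Type v} [MeasurableSpace Ω] {μ : Measure Ω} [IsProbabilityMeasure μ]
  {w x y : V → ℤ → Ω → ℝ}

theorem IsGenerativeModel.invPSD_state (hm : IsGenerativeModel μ s b w x) (θ : ℝ) :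
    invPSD μ x θ =
      precision (fun i => dtft (s i) θ) b (fun i => (crossPSD μ (w i) (w i) θ).re) :=
  Matrix.inv_eq_right_inv (hm.psd_state_mul_precision θ)

theorem reconstruction_correct {Y : Set V} {h : V → ℝ → ℂ} {d : V → ℝ → ℝ}
    (hm : IsGenerativeModel μ s b w x) (hb : IsBidirected s b) (hT : (topology s b).IsTree)
    (h2 : HasTwoHop (topology s b)) (hY : IsDeep (topology s b) Y)
    (hc : IsCorruption μ Y x y h d) (hn : IsNondegenerate μ (topology s b) Y x y) :
    detect μ y = trueDetection (topology s b) Y ∧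
      hideAndLearn μ y (trueDetection (topology s b) Y) = (topology s b).edgeSet := by
  have hN : TreeNetwork (topology s b) Y b (fun θ i => dtft (s i) θ)
      (fun θ i => (crossPSD μ (w i) (w i) θ).re) :=
    { tree := hT
      supp := supportedOn_topology hm.filter_ne_zero hb
      deep := hY
      filter_ne := fun θ i => hm.filter_ne_zero i θ
      noise_pos := fun θ i => hm.noise_pos i θ
      edge := fun i j hij => by simpa only [hm.invPSD_state] using hn.edge i j hij
      corner := fun l hl q r h1 h2 h3 => by
        simpa only [hm.invPSD_state] using hn.corner l hl q r h1 h2 h3 }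
  have hP := hm.psd_state_mul_precision
  have R := hN.revealsTree hc hP h2 hn.measured
  exact ⟨R.detect_eq hT h2 hY, hideAndLearn_eq R hT hY (hN.hidden_adj_iff hc hP hn.hidden)⟩

end Correctness

/-! ### Analytic dependence on the couplings -/

section Analytic

/-- The couplings with value `1` on a single directed edge. -/
def singleCoupling {V : Type u} [DecidableEq V] (i j : V) : V → V → ℝ := fun a c => if a = i ∧ c = j then 1 else 0

theorem couplingOn_single {V : Type u} [DecidableEq V] {T : SimpleGraph V} {i j : V} (hij : T.Adj i j) :
    couplingOn T (singleCoupling i j) = singleCoupling i j := by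
  ext a c
  by_cases h : a = i ∧ c = j
  · obtain ⟨rfl, rfl⟩ := h
    simp [couplingOn, hij]
  · simp [couplingOn, singleCoupling, h]

variable {E : Type*} [NormedAddCommGroup E] [NormedSpace ℝ E]

theorem AnalyticAt.ofReal_comp {f : E → ℝ} {z : E} (hf : AnalyticAt ℝ f z) :
    AnalyticAt ℝ (fun x => (f x : ℂ)) z :=
  (Complex.ofRealCLM.analyticAt _).comp hf

theorem AnalyticAt.star_comp {f : E → ℂ} {z : E} (hf : AnalyticAt ℝ f z) :
    AnalyticAt ℝ (fun x => star (f x)) z :=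
  ((Complex.conjCLE : ℂ →L[ℝ] ℂ).analyticAt _).comp hf

theorem AnalyticAt.ofReal_im_comp {f : E → ℂ} {z : E} (hf : AnalyticAt ℝ f z) :
    AnalyticAt ℝ (fun x => ((f x).im : ℂ)) z :=
  AnalyticAt.ofReal_comp ((Complex.imCLM.analyticAt _).comp hf)

variable {V : Type u} [Fintype V] (T : SimpleGraph V)

theorem analyticAt_coupling (i j : V) (z : V → V → ℝ) :
    AnalyticAt ℝ (fun β : V → V → ℝ => β i j) z :=
  ((ContinuousLinearMap.proj (R := ℝ) (φ := fun _ : V => ℝ) j).comp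
    (ContinuousLinearMap.proj (R := ℝ) (φ := fun _ : V => V → ℝ) i)).analyticAt z

theorem ae_couplings_ne_zero {f : (V → V → ℝ) → ℂ} (hf : ∀ z, AnalyticAt ℝ f z)
    (z : V → V → ℝ) (hz : f z ≠ 0) : ∀ᵐ β : V → V → ℝ, f β ≠ 0 :=
  analyticZerosNull_couplings V f (fun z _ => hf z) ⟨z, hz⟩

variable [DecidableEq V]

theorem analyticAt_netMatrix (S : V → ℂ) (i j : V) (z : V → V → ℝ) :
    AnalyticAt ℝ (fun β => netMatrix S (couplingOn T β) i j) z := by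
  by_cases hij : i = j
  · simp only [hij, netMatrix_diag]
    exact analyticAt_const
  simp only [netMatrix_offdiag S _ hij]
  refine (AnalyticAt.ofReal_comp ?_).neg
  by_cases h : T.Adj i j
  · simp only [couplingOn, if_pos h]
    exact analyticAt_coupling i j z
  · simp only [couplingOn, if_neg h]
    exact analyticAt_const

theorem analyticAt_precision (S : V → ℂ) (φ : V → ℝ) (i j : V) (z : V → V → ℝ) :
    AnalyticAt ℝ (fun β => precision S (couplingOn T β) φ i j) z := by
  simp only [precision_apply]
  exact Finset.analyticAt_fun_sum _ fun k _ =>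
    ((AnalyticAt.star_comp (analyticAt_netMatrix T S k i z)).mul analyticAt_const).mul
      (analyticAt_netMatrix T S k j z)

theorem analyticAt_precisionDiag (S : V → ℂ) (φ : V → ℝ) (l : V) (z : V → V → ℝ) :
    AnalyticAt ℝ (fun β => (precisionDiag S (couplingOn T β) φ l : ℂ)) z := by
  simp only [← precision_diag]
  exact analyticAt_precision T S φ l l z

theorem analyticAt_corrected (S : V → ℂ) (φ : V → ℝ) {γ : (V → V → ℝ) → V → ℝ}
    {z : V → V → ℝ} (hγ : ∀ l, AnalyticAt ℝ (fun β => (γ β l : ℂ)) z) (i j : V) :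
    AnalyticAt ℝ (fun β => corrected (precision S (couplingOn T β) φ) (γ β) i j) z := by
  simp only [corrected_apply]
  exact (analyticAt_precision T S φ i j z).sub (Finset.analyticAt_fun_sum _ fun l _ =>
    ((analyticAt_precision T S φ i l z).mul (hγ l)).mul (analyticAt_precision T S φ l j z))

theorem analyticAt_measuredWeight (S : V → ℂ) {φ : V → ℝ} (hφ : ∀ k, 0 < φ k) {e : V → ℝ}
    (he : ∀ l, 0 ≤ e l) (l : V) (z : V → V → ℝ) :
    AnalyticAt ℝ (fun β =>
      (measuredWeight e (precisionDiag S (couplingOn T β) φ) l : ℂ)) z := by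
  simp only [measuredWeight, Complex.ofReal_div, Complex.ofReal_add, Complex.ofReal_mul,
    Complex.ofReal_one]
  refine analyticAt_const.div (analyticAt_const.add
    (analyticAt_const.mul (analyticAt_precisionDiag T S φ l z))) ?_
  have h := mul_nonneg (he l) (precisionDiag_nonneg S (couplingOn T z) hφ l)
  exact_mod_cast (by linarith : (0 : ℝ) < 1 + e l * precisionDiag S (couplingOn T z) φ l).ne'

theorem analyticAt_hiddenWeight {S : V → ℂ} (hS : ∀ k, S k ≠ 0) {φ : V → ℝ}
    (hφ : ∀ k, 0 < φ k) (Y : Set V) (l : V) (z : V → V → ℝ) :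
    AnalyticAt ℝ (fun β =>
      (hiddenWeight Y (precisionDiag S (couplingOn T β) φ) l : ℂ)) z := by
  by_cases hl : l ∈ Y
  · simp only [hiddenWeight, if_pos hl, Complex.ofReal_inv]
    exact (analyticAt_precisionDiag T S φ l z).inv
      (Complex.ofReal_ne_zero.2 (precisionDiag_pos hS _ hφ l).ne')
  · simp only [hiddenWeight, if_neg hl]
    exact analyticAt_const

/-- If, among the rows of `S - B`, only row `i` has nonzero entries in both columns `i` and `j`,
then the entry `(i, j)` of the inverse spectrum is a single term. -/
theorem precision_of_one_way (S : V → ℂ) {b : V → V → ℝ} (φ : V → ℝ) {i j : V} (hij : i ≠ j)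
    (hji : b j i = 0) (hk : ∀ k, k ≠ i → k ≠ j → b k i = 0 ∨ b k j = 0) :
    precision S b φ i j = -(star (S i) * ((φ i)⁻¹ : ℂ) * (b i j : ℂ)) := by
  rw [precision_apply, Finset.sum_eq_single i _ (by simp), netMatrix_diag,
    netMatrix_offdiag S b hij, mul_neg]
  intro k _ hki
  rw [netMatrix_offdiag S b hki]
  by_cases hkj : k = j
  · rw [hkj, hji]
    simp
  · rw [netMatrix_offdiag S b hkj]
    rcases hk k hki hkj with h | h <;> simp [h]

variable {T}

theorem precision_single (S : V → ℂ) (φ : V → ℝ) {i j : V} (hij : T.Adj i j) (l : V)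
    (hl : l ≠ i) :
    precision S (couplingOn T (singleCoupling i j)) φ i l =
      -(star (S i) * ((φ i)⁻¹ : ℂ) * if l = j then 1 else 0) := by
  rw [couplingOn_single hij, precision_of_one_way S φ hl.symm]
  · by_cases hlj : l = j <;> simp [singleCoupling, hlj]
  · simp [singleCoupling, hij.ne]
  · intro k _ _
    simp [singleCoupling, hij.ne]

theorem ae_edge {s : V → ℤ → ℝ} {φ : V → ℝ → ℝ} (hφ : ∀ i θ, 0 < φ i θ) {i j : V}
    (hij : T.Adj i j) (hs : ∃ θ ∈ Set.Ioc (-Real.pi) Real.pi,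
      (dtft (s i) θ * dtft (s j) θ).im ≠ 0) :
    ∀ᵐ β : V → V → ℝ, ∃ θ ∈ Set.Ioc (-Real.pi) Real.pi,
      (precision (fun i => dtft (s i) θ) (couplingOn T β) (fun i => φ i θ) i j).im ≠ 0 := by
  obtain ⟨θ, hθ, h⟩ := hs
  set S : V → ℂ := fun i => dtft (s i) θ
  have hinv : ∀ i, (φ i θ)⁻¹ ≠ 0 := fun i => inv_ne_zero (hφ i θ).ne'
  -- at least one of the two responses is not real
  have hor : (S i).im ≠ 0 ∨ (S j).im ≠ 0 := by
    by_contra hcon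
    push Not at hcon
    refine h ?_
    change (S i * S j).im = 0
    rw [Complex.mul_im, hcon.1, hcon.2]
    ring
  have hval : ∀ i j, T.Adj i j → (S i).im ≠ 0 →
      (precision S (couplingOn T (singleCoupling i j)) (fun i => φ i θ) i j).im ≠ 0 := by
    intro i j hij hi
    rw [precision_single S _ hij j hij.ne', if_pos rfl, mul_one, ← Complex.ofReal_inv,
      Complex.neg_im, Complex.im_mul_ofReal, Complex.star_def, Complex.conj_im]
    exact neg_ne_zero.2 (mul_ne_zero (neg_ne_zero.2 hi) (hinv i))
  have hex : ∃ z, (precision S (couplingOn T z) (fun i => φ i θ) i j).im ≠ 0 := by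
    rcases hor with hi | hj
    · exact ⟨_, hval i j hij hi⟩
    · refine ⟨singleCoupling j i, ?_⟩
      rw [← star_precision, Complex.star_def, Complex.conj_im]
      exact neg_ne_zero.2 (hval j i hij.symm hj)
  obtain ⟨z, hz⟩ := hex
  filter_upwards [ae_couplings_ne_zero (fun z => AnalyticAt.ofReal_im_comp
    (analyticAt_precision T S (fun i => φ i θ) i j z)) z (Complex.ofReal_ne_zero.2 hz)] with β hβ
  exact ⟨θ, hθ, Complex.ofReal_ne_zero.1 hβ⟩

/-- At the couplings `b_ql = b_lr = 1`, all others zero, the product of the two entries is a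
positive multiple of the conjugate of `S_q S_l`. -/
theorem ae_corner {s : V → ℤ → ℝ} {φ : V → ℝ → ℝ} (hφ : ∀ i θ, 0 < φ i θ) {q l r : V}
    (hql : T.Adj q l) (hlr : T.Adj l r) (hqr : q ≠ r)
    (hs : ∃ θ ∈ Set.Ioc (-Real.pi) Real.pi, (dtft (s q) θ * dtft (s l) θ).im ≠ 0) :
    ∀ᵐ β : V → V → ℝ, ∃ θ ∈ Set.Ioc (-Real.pi) Real.pi,
      (precision (fun i => dtft (s i) θ) (couplingOn T β) (fun i => φ i θ) q l *
        precision (fun i => dtft (s i) θ) (couplingOn T β) (fun i => φ i θ) l r).im ≠ 0 := by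
  obtain ⟨θ, hθ, h⟩ := hs
  set S : V → ℂ := fun i => dtft (s i) θ
  set z : V → V → ℝ := fun a c => if (a = q ∧ c = l) ∨ (a = l ∧ c = r) then 1 else 0 with hz
  have hcz : couplingOn T z = z := by
    ext a c
    by_cases hac : (a = q ∧ c = l) ∨ (a = l ∧ c = r)
    · have hadj : T.Adj a c := by
        rcases hac with ⟨rfl, rfl⟩ | ⟨rfl, rfl⟩
        · exact hql
        · exact hlr
      simp [couplingOn, hadj]
    · simp [couplingOn, hz, hac]
  have hne : (precision S (couplingOn T z) (fun i => φ i θ) q l *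
      precision S (couplingOn T z) (fun i => φ i θ) l r).im ≠ 0 := by
    have e1 : z q l = 1 := by simp [hz]
    have e2 : z l r = 1 := by simp [hz]
    have e3 : ∀ k, z k q = 0 := fun k => by simp [hz, hql.ne, hqr]
    have e4 : z r l = 0 := by simp [hz, hqr.symm, hlr.ne]
    have e5 : ∀ k, k ≠ l → z k r = 0 := fun k hk => by simp [hz, hk, hlr.ne']
    rw [hcz, precision_of_one_way S _ hql.ne (e3 l) fun k _ _ => Or.inl (e3 k),
      precision_of_one_way S _ hlr.ne e4 fun k hk _ => Or.inr (e5 k hk), e1, e2]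
    have e6 : -(star (S q) * ((φ q θ : ℝ) : ℂ)⁻¹ * ((1 : ℝ) : ℂ)) *
        -(star (S l) * ((φ l θ : ℝ) : ℂ)⁻¹ * ((1 : ℝ) : ℂ)) =
        star (S q * S l) * (((φ q θ)⁻¹ * (φ l θ)⁻¹ : ℝ) : ℂ) := by
      push_cast
      rw [star_mul']
      ring
    rw [e6, Complex.im_mul_ofReal, Complex.star_def, Complex.conj_im]
    exact mul_ne_zero (neg_ne_zero.2 h)
      (mul_ne_zero (inv_ne_zero (hφ q θ).ne') (inv_ne_zero (hφ l θ).ne'))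
  filter_upwards [ae_couplings_ne_zero (fun z => AnalyticAt.ofReal_im_comp
    ((analyticAt_precision T S (fun i => φ i θ) q l z).mul
      (analyticAt_precision T S (fun i => φ i θ) l r z))) z (Complex.ofReal_ne_zero.2 hne)]
    with β hβ
  exact ⟨θ, hθ, Complex.ofReal_ne_zero.1 hβ⟩

/-- An edge between clean nodes is generically not cancelled by the correction: with a single
nonzero coupling on this edge there is no correction. -/
theorem ae_corrected_ne_zero {S : V → ℂ} (hS : ∀ k, S k ≠ 0) {φ : V → ℝ} (hφ : ∀ k, 0 < φ k)
    {Y : Set V} {γ : (V → V → ℝ) → V → ℝ}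
    (hγ : ∀ z l, AnalyticAt ℝ (fun β => (γ β l : ℂ)) z) (hγY : ∀ β, ∀ l ∉ Y, γ β l = 0)
    {i j : V} (hi : i ∉ Y) (hj : j ∉ Y) (hij : T.Adj i j) :
    ∀ᵐ β : V → V → ℝ, corrected (precision S (couplingOn T β) φ) (γ β) i j ≠ 0 := by
  refine ae_couplings_ne_zero (fun z => analyticAt_corrected T S φ (hγ z) i j)
    (singleCoupling i j) ?_
  rw [corrected_apply, Finset.sum_eq_zero, sub_zero, precision_single S φ hij j hij.ne']
  · rw [if_pos rfl, mul_one]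
    exact neg_ne_zero.2 (mul_ne_zero (star_ne_zero.2 (hS i))
      (inv_ne_zero (Complex.ofReal_ne_zero.2 (hφ i).ne')))
  · intro l _
    by_cases hl : l ∈ Y
    · have hli : l ≠ i := by rintro rfl; exact hi hl
      have hlj : l ≠ j := by rintro rfl; exact hj hl
      rw [precision_single S φ hij l hli, if_neg hlj]
      simp
    · simp [hγY _ l hl]

end Analytic

/-! ### Genericity of the nondegeneracy conditions -/

section Generic

theorem supportedOn_couplingOn {V : Type u} {T : SimpleGraph V} {β : V → V → ℝ}
    (hβ : ∀ i j, T.Adj i j → β i j ≠ 0) :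
    SupportedOn T (couplingOn T β) := by
  intro i j _
  by_cases h : T.Adj i j
  · simp [couplingOn, h, hβ i j h]
  · simp [couplingOn, h]

theorem topology_eq {V : Type u} [DecidableEq V] {T : SimpleGraph V} {s : V → ℤ → ℝ}
    (hS : ∀ i θ, dtft (s i) θ ≠ 0) {b : V → V → ℝ} (hb : SupportedOn T b) :
    topology s b = T ∧ IsBidirected s b := by
  have hl : ∀ i j, Link s b i j ↔ T.Adj i j := fun i j => by
    rw [link_iff hS]
    constructor
    · rintro ⟨h1, h2⟩
      exact ((hb j i h1.symm).1 h2).symm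
    · intro h
      exact ⟨h.ne, (hb j i h.ne').2 h.symm⟩
  refine ⟨?_, fun i j h => (hl j i).2 ((hl i j).1 h).symm⟩
  ext i j
  rw [topology, SimpleGraph.fromRel_adj, hl, hl]
  exact ⟨fun h => h.2.elim id SimpleGraph.Adj.symm, fun h => ⟨h.ne, Or.inl h⟩⟩

variable {V : Type u} [Fintype V] [DecidableEq V] {T : SimpleGraph V} {s : V → ℤ → ℝ}

/-- All nondegeneracy conditions hold for almost every choice of couplings: each is the
nonvanishing, at one frequency, of a real-analytic function of the couplings that does not vanish
identically. -/
theorem ae_nondegenerate {Y : Set V} {φ : V → ℝ → ℝ} {h : V → ℝ → ℂ} {d : V → ℝ → ℝ}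
    (hT : T.IsTree) (hY : IsDeep T Y)
    (hs : ∀ i j, T.Adj i j → ∃ θ ∈ Set.Ioc (-Real.pi) Real.pi,
      (dtft (s i) θ * dtft (s j) θ).im ≠ 0) :
    ∀ᵐ β : V → V → ℝ,
      ∀ (Ω : Type v) [MeasurableSpace Ω] (μ : Measure Ω) [IsProbabilityMeasure μ]
        (w x y : V → ℤ → Ω → ℝ),
        IsGenerativeModel μ s (couplingOn T β) w x →
        (∀ i θ, crossPSD μ (w i) (w i) θ = (φ i θ : ℂ)) →
        IsCorruption μ Y x y h d →
        topology s (couplingOn T β) = T ∧ IsBidirected s (couplingOn T β) ∧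
        IsNondegenerate μ T Y x y := by
  -- if the data are inadmissible, there is no network having them
  by_cases hgood : (∀ i θ, dtft (s i) θ ≠ 0) ∧ (∀ i θ, 0 < φ i θ) ∧
      (∀ i θ, 0 ≤ d i θ) ∧ ∀ i, i ∉ Y → ∀ θ, d i θ = 0
  swap
  · refine Filter.Eventually.of_forall fun β Ω _ μ _ w x y hm hw hc => (hgood ?_).elim
    refine ⟨hm.filter_ne_zero, fun i θ => ?_, fun i θ => ?_, hc.d_clean⟩
    · simpa [hw] using hm.noise_pos i θ
    · by_cases hi : i ∈ Y
      · exact (hc.d_pos i hi θ).le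
      · exact (hc.d_clean i hi θ).ge
  obtain ⟨hS, hφ, hd, hd0⟩ := hgood
  have a1 : ∀ᵐ β : V → V → ℝ, ∀ i j, T.Adj i j → β i j ≠ 0 := by
    refine ae_all_iff.2 fun i => ae_all_iff.2 fun j => ae_all_iff.2 fun _ => ?_
    filter_upwards [ae_couplings_ne_zero (fun z => AnalyticAt.ofReal_comp
      (analyticAt_coupling i j z)) (fun _ _ => 1) (by simp)] with β hβ
    exact Complex.ofReal_ne_zero.1 hβ
  have a2 : ∀ᵐ β : V → V → ℝ, ∀ i j, T.Adj i j → ∃ θ ∈ Set.Ioc (-Real.pi) Real.pi,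
      (precision (fun i => dtft (s i) θ) (couplingOn T β) (fun i => φ i θ) i j).im ≠ 0 :=
    ae_all_iff.2 fun i => ae_all_iff.2 fun j => ae_all_iff.2 fun hij =>
      ae_edge hφ hij (hs i j hij)
  have a3 : ∀ᵐ β : V → V → ℝ, ∀ l q r, T.Adj q l → T.Adj l r → q ≠ r →
      ∃ θ ∈ Set.Ioc (-Real.pi) Real.pi,
      (precision (fun i => dtft (s i) θ) (couplingOn T β) (fun i => φ i θ) q l *
        precision (fun i => dtft (s i) θ) (couplingOn T β) (fun i => φ i θ) l r).im ≠ 0 :=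
    ae_all_iff.2 fun l => ae_all_iff.2 fun q => ae_all_iff.2 fun r => ae_all_iff.2 fun h1 =>
      ae_all_iff.2 fun h2 => ae_all_iff.2 fun h3 => ae_corner hφ h1 h2 h3 (hs q l h1)
  have a4 : ∀ᵐ β : V → V → ℝ, ∀ i j, i ∉ Y → j ∉ Y → T.Adj i j →
      corrected (precision (fun i => dtft (s i) 0) (couplingOn T β) (fun i => φ i 0))
        (measuredWeight (fun l => d l 0 / Complex.normSq (h l 0))
          (precisionDiag (fun i => dtft (s i) 0) (couplingOn T β) (fun i => φ i 0))) i j ≠ 0 :=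
    ae_all_iff.2 fun i => ae_all_iff.2 fun j => ae_all_iff.2 fun hi => ae_all_iff.2 fun hj =>
      ae_all_iff.2 fun hij => ae_corrected_ne_zero (fun i => hS i 0) (fun i => hφ i 0)
        (fun z l => analyticAt_measuredWeight T _ (fun i => hφ i 0)
          (fun l => div_nonneg (hd l 0) (Complex.normSq_nonneg _)) l z)
        (fun β l hl => by simp [measuredWeight, hd0 l hl 0]) hi hj hij
  have a5 : ∀ᵐ β : V → V → ℝ, ∀ i j, i ∉ Y → j ∉ Y → T.Adj i j →
      corrected (precision (fun i => dtft (s i) 0) (couplingOn T β) (fun i => φ i 0))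
        (hiddenWeight Y
          (precisionDiag (fun i => dtft (s i) 0) (couplingOn T β) (fun i => φ i 0))) i j ≠ 0 :=
    ae_all_iff.2 fun i => ae_all_iff.2 fun j => ae_all_iff.2 fun hi => ae_all_iff.2 fun hj =>
      ae_all_iff.2 fun hij => ae_corrected_ne_zero (fun i => hS i 0) (fun i => hφ i 0)
        (fun z l => analyticAt_hiddenWeight T (fun i => hS i 0) (fun i => hφ i 0) Y l z)
        (fun β l hl => by simp [hiddenWeight, hl]) hi hj hij
  filter_upwards [a1, a2, a3, a4, a5] with β h1 h2 h3 h4 h5 Ω _ μ _ w x y hm hw hc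
  have hb := supportedOn_couplingOn h1
  obtain ⟨htop, hbi⟩ := topology_eq (s := s) hS hb
  refine ⟨htop, hbi, ?_⟩
  have hre : ∀ θ, (fun i => (crossPSD μ (w i) (w i) θ).re) = fun i => φ i θ := fun θ => by
    ext i
    rw [hw, Complex.ofReal_re]
  have hP := hm.psd_state_mul_precision
  have hinv := hm.invPSD_state
  simp only [hre] at hP hinv
  have hφ' : ∀ θ k, 0 < φ k θ := fun θ k => hφ k θ
  have hS' : ∀ θ k, dtft (s k) θ ≠ 0 := fun θ k => hS k θ
  constructor
  · simpa only [hinv] using h2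
  · intro l _ q r
    simpa only [hinv] using h3 l q r
  · intro i j hi hj hij
    refine ⟨0, zero_mem_Ioc_pi, ?_⟩
    rw [invPSD_clean (S := fun θ i => dtft (s i) θ) (φ := fun θ i => φ i θ) hT hb hY hφ' hc hP 0
      hi hj]
    exact h4 i j hi hj hij
  · intro i j hij
    refine ⟨0, zero_mem_Ioc_pi, ?_⟩
    rw [hiddenInvPSD_eq_corrected (S := fun θ i => dtft (s i) θ) (φ := fun θ i => φ i θ)
      hT hb hY hS' hφ' hc hP 0 i j]
    exact h5 i.1 j.1 i.2 j.2 hij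

end Generic

end HideLearn

end

theorem mainTheorem1 {V : Type u} [Fintype V] [DecidableEq V] :
    -- correctness of the two algorithms for every non-pathological system
    (∀ (Ω : Type v) [MeasurableSpace Ω] (μ : Measure Ω) [IsProbabilityMeasure μ]
      (s : V → ℤ → ℝ) (b : V → V → ℝ) (w x y : V → ℤ → Ω → ℝ)
      (Y : Set V) (h : V → ℝ → ℂ) (d : V → ℝ → ℝ),
      HideLearn.IsGenerativeModel μ s b w x →
      HideLearn.IsBidirected s b →
      (HideLearn.topology s b).IsTree →
      HideLearn.HasTwoHop (HideLearn.topology s b) →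
      HideLearn.IsDeep (HideLearn.topology s b) Y →
      HideLearn.IsCorruption μ Y x y h d →
      HideLearn.IsNondegenerate μ (HideLearn.topology s b) Y x y →
      (HideLearn.detect μ y).corrupt = Y ∧
      (HideLearn.detect μ y).leaves = {i | HideLearn.IsLeaf (HideLearn.topology s b) i} ∧
      (HideLearn.detect μ y).leafEdges =
        {e | e ∈ (HideLearn.topology s b).edgeSet ∧
          ∃ i ∈ e, HideLearn.IsLeaf (HideLearn.topology s b) i} ∧
      HideLearn.hideAndLearn μ y (HideLearn.detect μ y) = (HideLearn.topology s b).edgeSet) ∧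
    -- pathological couplings form a null set
    (∀ (T : SimpleGraph V) (Y : Set V) (s : V → ℤ → ℝ) (φ : V → ℝ → ℝ)
      (h : V → ℝ → ℂ) (d : V → ℝ → ℝ),
      T.IsTree → HideLearn.HasTwoHop T → HideLearn.IsDeep T Y →
      (∀ i j, T.Adj i j → ∃ θ ∈ Set.Ioc (-Real.pi) Real.pi,
        (HideLearn.dtft (s i) θ * HideLearn.dtft (s j) θ).im ≠ 0) →
      ∀ᵐ β : V → V → ℝ,
        ∀ (Ω : Type v) [MeasurableSpace Ω] (μ : Measure Ω) [IsProbabilityMeasure μ]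
          (w x y : V → ℤ → Ω → ℝ),
          HideLearn.IsGenerativeModel μ s (HideLearn.couplingOn T β) w x →
          (∀ i θ, HideLearn.crossPSD μ (w i) (w i) θ = (φ i θ : ℂ)) →
          HideLearn.IsCorruption μ Y x y h d →
          HideLearn.topology s (HideLearn.couplingOn T β) = T ∧
          HideLearn.IsBidirected s (HideLearn.couplingOn T β) ∧
          HideLearn.IsNondegenerate μ T Y x y) := by
  refine ⟨?_, ?_⟩
  · intro Ω _ μ _ s b w x y Y h d hm hb hT h2 hY hc hn
    obtain ⟨hdet, hlearn⟩ := HideLearn.reconstruction_correct hm hb hT h2 hY hc hn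
    rw [hdet]
    exact ⟨rfl, rfl, rfl, hlearn⟩
  · intro T Y s φ h d hT _ hY hs
    exact HideLearn.ae_nondegenerate hT hY hs
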